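/- **Setting.** Let $\mathbb{R}^{1,3}$ be $\mathbb{R}^4$ with the metric $\langle\cdot,\cdot\rangle=-dx_0^2+dx_1^2+dx_2^2+dx_3^2$, its canonical orientation, and the time orientation given by $x_0$. Let $\mathbb{H}^{\mathbb{C}}$ be the algebra of complex quaternions $q_0+q_1I+q_2J+q_3K$ ($q_j\in\mathbb{C}$, $I^2=J^2=K^2=-1$, $IJ=-JI=K$), with the complex bilinear form $H(q,q')=\sum_j q_jq_j'$; let $\hat q$ denote $q$ with its four coefficients conjugated. Identify $x\in\mathbb{R}^{1,3}$ with $[x]=ix_0+x_1I+x_2J+x_3K$, and the bivector $v\wedge w$ with $\frac12([v]\widehat{[w]}-[w]\widehat{[v]})$, an element of $\Im m\,\mathbb{H}^{\mathbb{C}}=\mathbb{C}I\oplus\mathbb{C}J\oplus\mathbb{C}K$. Let $$\mathcal{Q}=\{Z_1I+Z_2J+Z_3K:\ (Z_1,Z_2,Z_3)\in\mathbb{C}^3,\ Z_1^2+Z_2^2+Z_3^2=1\},\qquad T_p\mathcal{Q}=\{\xi\in\Im m\,\mathbb{H}^{\mathbb{C}}:\ H(\xi,p)=0\},$$ with the complex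 area form $\omega_{\mathcal{Q},p}(\xi,\xi')=H(\xi\times\xi',p)$, where $\xi\times\xi'=\frac12(\xi\xi'-\xi'\xi)$. Let $M$ be an oriented Riemannian surface with area form $\omega_M$, and let $F:M\to\mathbb{R}^{1,3}$ be a smooth isometric immersion. Let $K$ be the Gauss curvature of $M$. Let $K_N=\langle R^E(e_2,e_3)e_0,e_1\rangle$ be the curvature of the normal bundle $E$ with its normal connection, where $R^E(X,Y)=[\nabla_X,\nabla_Y]-\nabla_{[X,Y]}$, where $(e_2,e_3)$ is a positively oriented orthonormal basis of $T_xM$, and where $(e_0,e_1)$ is an orthonormal basis of the normal plane with $e_0$ timelike and future directed and $(e_0,e_1,e_2,e_3)$ positively oriented in $\mathbb{R}^{1,3}$. Let $G(x)=u_1\wedge u_2$ be the Gauss map, where $(u_1,u_2)$ is the image by $dF_x$ of a positively oriented orthonormal basis of $T_xM$. **Proposition 6.3.** The map that sends an oriented spacelike plane with positively oriented orthonormal basis $(u_1,u_2)$ to $u_1\wedge u_2$ is a bijection from the Grassmannian of oriented spacelike planes of $\mathbb{R}^{1,3}$ onto $\mathcal{Q}$. The Gauss map $G:M\to\mathcal{Q}$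 is smooth, its differential $dG_x$ takes values in $T_{G(x)}\mathcal{Q}$, and $$G^*\omega_{\mathcal{Q}}=(K+iK_N)\,\omega_M .$$ In particular, for every $x\in M$, $K(x)=K_N(x)=0$ if and only if $dG_x(T_xM)$ is contained in some complex line of $T_{G(x)}\mathcal{Q}$. -/

import Mathlib

open Module Bundle
open scoped Manifold ContDiff Quaternion

noncomputable section

namespace MinkowskiSurface

/-! ### Complex quaternions and Minkowski space -/

/-- The complex bilinear form `H` on the complex quaternions. -/
def bilinH (p q : ℍ[ℂ]) : ℂ :=
  p.re * q.re + p.imI * q.imI + p.imJ * q.imJ + p.imK * q.imK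

/-- Complex conjugation of the four coefficients. -/
def hat (q : ℍ[ℂ]) : ℍ[ℂ] :=
  ⟨starRingEnd ℂ q.re, starRingEnd ℂ q.imI, starRingEnd ℂ q.imJ, starRingEnd ℂ q.imK⟩

/-- The vectorial product `½ (p q - q p)`. -/
def cross (p q : ℍ[ℂ]) : ℍ[ℂ] := (1 / 2 : ℂ) • (p * q - q * p)

/-- The mixed product `[p, q, r] = H (p × q, r)`. -/
def mixed (p q r : ℍ[ℂ]) : ℂ := bilinH (cross p q) r

/-- The vector space underlying Minkowski space `ℝ^{1,3}`. -/
abbrev Mink : Type := Fin 4 → ℝ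

/-- The metric `-dx₀² + dx₁² + dx₂² + dx₃²`. -/
def mink (v w : Mink) : ℝ := -(v 0 * w 0) + v 1 * w 1 + v 2 * w 2 + v 3 * w 3

/-- The vector `x` seen as the complex quaternion `i x₀ 1 + x₁ I + x₂ J + x₃ K`. -/
def toQuat (v : Mink) : ℍ[ℂ] := ⟨Complex.I * (v 0 : ℂ), (v 1 : ℂ), (v 2 : ℂ), (v 3 : ℂ)⟩

/-- The bivector `v ∧ w = ½ (v · w - w · v)` as an even element of the Clifford algebra. The
Clifford product of two vectors `v`, `w` is the even element represented by the complex
quaternion `v ŵ`. In particular `e₂ ∧ e₃ = I`, `e₃ ∧ e₁ = J` and `e₁ ∧ e₂ = K`. -/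
def bivector (v w : Mink) : ℍ[ℂ] :=
  (1 / 2 : ℂ) • (toQuat v * hat (toQuat w) - toQuat w * hat (toQuat v))

/-! ### The Grassmannian of oriented spacelike planes and the complex quadric -/

/-- The pair `(v, w)` is an orthonormal basis of a spacelike plane. -/
def IsSpacelikePair (v w : Mink) : Prop := mink v v = 1 ∧ mink w w = 1 ∧ mink v w = 0

/-- Orthonormal bases of spacelike planes. -/
abbrev SpacelikePair : Type := {p : Mink × Mink // IsSpacelikePair p.1 p.2}

/-- Two orthonormal pairs are bases of the same plane, with the same orientation, when they
differ by a rotation. -/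
def samePlane (p q : SpacelikePair) : Prop :=
  ∃ θ : ℝ, q.1.1 = Real.cos θ • p.1.1 + Real.sin θ • p.1.2 ∧
    q.1.2 = -Real.sin θ • p.1.1 + Real.cos θ • p.1.2

theorem samePlane_equivalence : Equivalence samePlane := by
  refine ⟨fun p => ⟨0, by simp, by simp⟩, ?_, ?_⟩
  · rintro p q ⟨θ, h1, h2⟩
    refine ⟨-θ, ?_, ?_⟩
    · rw [h1, h2]
      ext i
      simp only [Real.cos_neg, Real.sin_neg, Pi.add_apply, Pi.smul_apply, smul_eq_mul]
      linear_combination (-(p.1.1 i)) * Real.sin_sq_add_cos_sq θ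
    · rw [h1, h2]
      ext i
      simp only [Real.cos_neg, Real.sin_neg, Pi.add_apply, Pi.smul_apply, smul_eq_mul]
      linear_combination (-(p.1.2 i)) * Real.sin_sq_add_cos_sq θ
  · rintro p q r ⟨θ, h1, h2⟩ ⟨τ, h3, h4⟩
    refine ⟨θ + τ, ?_, ?_⟩
    · rw [h3, h1, h2]
      ext i
      simp only [Real.cos_add, Real.sin_add, Pi.add_apply, Pi.smul_apply, smul_eq_mul]
      ring
    · rw [h4, h1, h2]
      ext i
      simp only [Real.cos_add, Real.sin_add, Pi.add_apply, Pi.smul_apply, smul_eq_mul]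
      ring

/-- The equivalence relation whose classes are the oriented spacelike planes. -/
def planeSetoid : Setoid SpacelikePair := ⟨samePlane, samePlane_equivalence⟩

/-- The Grassmannian of oriented spacelike planes of Minkowski space: an oriented spacelike plane
is the class of its positively oriented orthonormal bases. -/
def OrientedSpacelikePlane : Type := Quotient planeSetoid

/-- The complex quadric `{Z₁ I + Z₂ J + Z₃ K : Z₁² + Z₂² + Z₃² = 1}`. -/
def quadric : Set ℍ[ℂ] := {Z | Z.re = 0 ∧ Z.imI ^ 2 + Z.imJ ^ 2 + Z.imK ^ 2 = 1}

theorem bivector_eq (v w : Mink) : bivector v w =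
    ⟨0, (v 2 * w 3 - v 3 * w 2 : ℂ) + Complex.I * (v 0 * w 1 - v 1 * w 0),
      (v 3 * w 1 - v 1 * w 3 : ℂ) + Complex.I * (v 0 * w 2 - v 2 * w 0),
      (v 1 * w 2 - v 2 * w 1 : ℂ) + Complex.I * (v 0 * w 3 - v 3 * w 0)⟩ := by
  ext <;> simp only [bivector, Quaternion.re_smul, Quaternion.imI_smul, Quaternion.imJ_smul,
    Quaternion.imK_smul, Quaternion.re_sub, Quaternion.imI_sub, Quaternion.imJ_sub,
    Quaternion.imK_sub, Quaternion.re_mul, Quaternion.imI_mul, Quaternion.imJ_mul,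
    Quaternion.imK_mul] <;> simp only [toQuat, hat, map_mul, Complex.conj_I, Complex.conj_ofReal,
    smul_eq_mul] <;> ring

theorem bivector_mem_quadric {v w : Mink} (h : IsSpacelikePair v w) :
    bivector v w ∈ quadric := by
  obtain ⟨h1, h2, h3⟩ := h
  simp only [mink] at h1 h2 h3
  have h1' : (-(v 0 * v 0) + v 1 * v 1 + v 2 * v 2 + v 3 * v 3 : ℂ) = 1 := by exact_mod_cast h1
  have h2' : (-(w 0 * w 0) + w 1 * w 1 + w 2 * w 2 + w 3 * w 3 : ℂ) = 1 := by exact_mod_cast h2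
  have h3' : (-(v 0 * w 0) + v 1 * w 1 + v 2 * w 2 + v 3 * w 3 : ℂ) = 0 := by exact_mod_cast h3
  rw [bivector_eq]
  refine ⟨rfl, ?_⟩
  linear_combination
    ((v 0 * w 1 - v 1 * w 0 : ℂ) ^ 2 + (v 0 * w 2 - v 2 * w 0 : ℂ) ^ 2
      + (v 0 * w 3 - v 3 * w 0 : ℂ) ^ 2) * Complex.I_sq
    + (-(w 0 * w 0) + w 1 * w 1 + w 2 * w 2 + w 3 * w 3 : ℂ) * h1' + h2'
    - (-(v 0 * w 0) + v 1 * w 1 + v 2 * w 2 + v 3 * w 3 : ℂ) * h3'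

theorem bivector_congr {p q : SpacelikePair} (h : samePlane p q) :
    bivector p.1.1 p.1.2 = bivector q.1.1 q.1.2 := by
  obtain ⟨θ, h1, h2⟩ := h
  have hθ : Complex.sin θ ^ 2 + Complex.cos θ ^ 2 = 1 := Complex.sin_sq_add_cos_sq θ
  rw [h1, h2, bivector_eq, bivector_eq]
  generalize p.1.1 = v
  generalize p.1.2 = w
  ext
  · rfl
  · simp
    linear_combination (-((v 2 * w 3 - v 3 * w 2 : ℂ) + Complex.I * (v 0 * w 1 - v 1 * w 0))) * hθ
  · simp
    linear_combination (-((v 3 * w 1 - v 1 * w 3 : ℂ) + Complex.I * (v 0 * w 2 - v 2 * w 0))) * hθ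
  · simp
    linear_combination (-((v 1 * w 2 - v 2 * w 1 : ℂ) + Complex.I * (v 0 * w 3 - v 3 * w 0))) * hθ

/-- The identification of the Grassmannian of oriented spacelike planes with the quadric: a plane
with positively oriented orthonormal basis `(u₁, u₂)` is sent to `u₁ ∧ u₂`. -/
def planeToQuadric : OrientedSpacelikePlane → quadric :=
  Quotient.lift (s := planeSetoid)
    (fun p => (⟨bivector p.1.1 p.1.2, bivector_mem_quadric p.2⟩ : quadric))
    (fun _ _ h => Subtype.ext (bivector_congr h))

/-- The tangent space of the quadric at `p`, a complex linear subspace. -/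
def quadricTangent (p : ℍ[ℂ]) : Submodule ℂ ℍ[ℂ] where
  carrier := {ξ | ξ.re = 0 ∧ bilinH ξ p = 0}
  zero_mem' := by simp [bilinH]
  add_mem' := by
    rintro a b ⟨ha, ha'⟩ ⟨hb, hb'⟩
    refine ⟨by simp [ha, hb], ?_⟩
    simp only [bilinH, Quaternion.re_add, Quaternion.imI_add, Quaternion.imJ_add,
      Quaternion.imK_add] at *
    linear_combination ha' + hb'
  smul_mem' := by
    rintro c a ⟨ha, ha'⟩
    refine ⟨by simp [ha], ?_⟩
    simp only [bilinH, Quaternion.re_smul, Quaternion.imI_smul, Quaternion.imJ_smul,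
      Quaternion.imK_smul, smul_eq_mul] at *
    linear_combination c * ha'

/-- The complex area form of the quadric, `ω_p (ξ, ξ') = [ξ, ξ', p]`. -/
def omegaQ (p ξ ξ' : ℍ[ℂ]) : ℂ := mixed ξ ξ' p

/-- The coordinates `(Z₁, Z₂, Z₃)` of an imaginary complex quaternion. -/
def imCoord (q : ℍ[ℂ]) : Fin 3 → ℂ := ![q.imI, q.imJ, q.imK]

/-- The imaginary complex quaternion with given coordinates. -/
def ofImCoord (z : Fin 3 → ℂ) : ℍ[ℂ] := ⟨0, z 0, z 1, z 2⟩

/-! ### Oriented spacelike surfaces -/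

/-- The model space of surfaces. -/
abbrev E2 : Type := EuclideanSpace ℝ (Fin 2)

variable {M : Type*} [TopologicalSpace M] [ChartedSpace E2 M]

instance fact_finrank (x : M) : Fact (finrank ℝ (TangentSpace 𝓘(ℝ, E2) x) = 2) :=
  ⟨finrank_euclideanSpace_fin (𝕜 := ℝ) (n := 2)⟩

/-- The `i`-th coordinate vector field of the chart at `x₀`, at the point with coordinates `y`. -/
def coordVec (x₀ : M) (y : E2) (i : Fin 2) :
    TangentSpace 𝓘(ℝ, E2) ((extChartAt 𝓘(ℝ, E2) x₀).symm y) :=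
  mfderiv 𝓘(ℝ, E2) 𝓘(ℝ, E2) (extChartAt 𝓘(ℝ, E2) x₀).symm y (EuclideanSpace.single i (1 : ℝ))

/-- The differential of a map into Minkowski space. -/
def dMink (F : M → Mink) (x : M) (u : TangentSpace 𝓘(ℝ, E2) x) : Mink :=
  mfderiv 𝓘(ℝ, E2) 𝓘(ℝ, Mink) F x u

/-- The partial derivative in the `i`-th coordinate direction. -/
def pd (i : Fin 2) (f : E2 → ℝ) (y : E2) : ℝ := fderiv ℝ f y (EuclideanSpace.single i (1 : ℝ))

instance finiteDimensional_tangentSpace (x : M) :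
    FiniteDimensional ℝ (TangentSpace 𝓘(ℝ, E2) x) :=
  inferInstanceAs (FiniteDimensional ℝ E2)

variable [RiemannianBundle (fun x : M => TangentSpace 𝓘(ℝ, E2) x)]

/-- The map `F` is a smooth isometric immersion of the Riemannian surface `M` in Minkowski
space. -/
structure IsIsometricImmersion (F : M → Mink) : Prop where
  smooth : ContMDiff 𝓘(ℝ, E2) 𝓘(ℝ, Mink) ∞ F
  isometric : ∀ (x : M) (u v : TangentSpace 𝓘(ℝ, E2) x),
    mink (dMink F x u) (dMink F x v) = inner ℝ u v

/-- The family `o` of orientations of the tangent planes is an orientation of `M`: around every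
point, it is the orientation of the coordinate frame `(∂₁, ∂₂)` of the chart at this point, or it
is the opposite orientation. -/
def IsSurfaceOrientation (o : ∀ x : M, Orientation ℝ (TangentSpace 𝓘(ℝ, E2) x) (Fin 2)) : Prop :=
  ∀ x₀ : M,
    (∀ᶠ y in nhds (extChartAt 𝓘(ℝ, E2) x₀ x₀),
      0 < (o ((extChartAt 𝓘(ℝ, E2) x₀).symm y)).areaForm (coordVec x₀ y 0) (coordVec x₀ y 1)) ∨
    (∀ᶠ y in nhds (extChartAt 𝓘(ℝ, E2) x₀ x₀),
      (o ((extChartAt 𝓘(ℝ, E2) x₀).symm y)).areaForm (coordVec x₀ y 0) (coordVec x₀ y 1) < 0)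

/-- A positively oriented orthonormal basis of the tangent plane. -/
def tangentFrame (o : ∀ x : M, Orientation ℝ (TangentSpace 𝓘(ℝ, E2) x) (Fin 2)) (x : M) :
    OrthonormalBasis (Fin 2) ℝ (TangentSpace 𝓘(ℝ, E2) x) :=
  (o x).finOrthonormalBasis two_pos (Fact.out)

theorem tangentFrame_pair {F : M → Mink} (hF : IsIsometricImmersion F)
    (o : ∀ x : M, Orientation ℝ (TangentSpace 𝓘(ℝ, E2) x) (Fin 2)) (x : M) :
    IsSpacelikePair (dMink F x (tangentFrame o x 0)) (dMink F x (tangentFrame o x 1)) := by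
  refine ⟨?_, ?_, ?_⟩ <;> rw [hF.isometric, OrthonormalBasis.inner_eq_ite] <;> simp

/-- The Gauss map, with values in the Grassmannian of oriented spacelike planes: the image of the
oriented tangent plane. -/
def gaussPlane {F : M → Mink} (hF : IsIsometricImmersion F)
    (o : ∀ x : M, Orientation ℝ (TangentSpace 𝓘(ℝ, E2) x) (Fin 2)) (x : M) :
    OrientedSpacelikePlane :=
  Quotient.mk planeSetoid
    ⟨(dMink F x (tangentFrame o x 0), dMink F x (tangentFrame o x 1)), tangentFrame_pair hF o x⟩

/-- The Gauss map, with values in the complex quadric. -/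
def gaussMap {F : M → Mink} (hF : IsIsometricImmersion F)
    (o : ∀ x : M, Orientation ℝ (TangentSpace 𝓘(ℝ, E2) x) (Fin 2)) (x : M) : ℍ[ℂ] :=
  (planeToQuadric (gaussPlane hF o x) : ℍ[ℂ])

/-- The differential of a map with values in the imaginary complex quaternions. -/
def dQuat (G : M → ℍ[ℂ]) (x : M) (u : TangentSpace 𝓘(ℝ, E2) x) : ℍ[ℂ] :=
  ofImCoord (mfderiv 𝓘(ℝ, E2) 𝓘(ℝ, Fin 3 → ℂ) (fun z => imCoord (G z)) x u)

/-! ### The Gauss curvature -/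

/-- The matrix `(g_ij)` of the metric in the chart at `x₀`, at the point with coordinates `y`. -/
def metricMatrix (x₀ : M) (y : E2) : Matrix (Fin 2) (Fin 2) ℝ :=
  Matrix.of fun i j => inner ℝ (coordVec x₀ y i) (coordVec x₀ y j)

/-- The Christoffel symbols `Γ^k_ij` of the Levi-Civita connection in the chart at `x₀`. -/
def christoffel (x₀ : M) (k i j : Fin 2) (y : E2) : ℝ :=
  (1 / 2) * ∑ l, (metricMatrix x₀ y)⁻¹ k l *
    (pd i (fun z => metricMatrix x₀ z j l) y + pd j (fun z => metricMatrix x₀ z i l) y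
      - pd l (fun z => metricMatrix x₀ z i j) y)

/-- The coefficient of `∂_l` in `R(∂_i, ∂_j) ∂_k`, where `R(X, Y) = [∇_X, ∇_Y] - ∇_[X, Y]`. -/
def riemannCoeff (x₀ : M) (l k i j : Fin 2) (y : E2) : ℝ :=
  pd i (christoffel x₀ l j k) y - pd j (christoffel x₀ l i k) y
    + ∑ m, (christoffel x₀ l i m y * christoffel x₀ m j k y
      - christoffel x₀ l j m y * christoffel x₀ m i k y)

/-- The Gauss curvature `K = ⟨R(∂₁, ∂₂) ∂₂, ∂₁⟩ / det g` of the Riemannian surface `M`. -/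
def gaussCurvature (x : M) : ℝ :=
  (∑ l, metricMatrix x (extChartAt 𝓘(ℝ, E2) x x) 0 l *
    riemannCoeff x l 1 0 1 (extChartAt 𝓘(ℝ, E2) x x)) /
    (metricMatrix x (extChartAt 𝓘(ℝ, E2) x x)).det

/-! ### The curvature of the normal bundle -/

/-- The orthogonal projection of Minkowski space on the normal plane at `x`. -/
def normalProj (F : M → Mink) (x : M) (v : Mink) : Mink :=
  v - ∑ i, mink v (dMink F x (stdOrthonormalBasis ℝ (TangentSpace 𝓘(ℝ, E2) x) i)) •
    dMink F x (stdOrthonormalBasis ℝ (TangentSpace 𝓘(ℝ, E2) x) i)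

/-- The normal connection, in the chart at `x₀`: the covariant derivative of the normal field `ν`
in the direction of the vector `a` at the point with coordinates `y`. It is the normal part of the
derivative in Minkowski space. -/
def normalDeriv (F : M → Mink) (x₀ : M) (a : E2) (ν : E2 → Mink) (y : E2) : Mink :=
  normalProj F ((extChartAt 𝓘(ℝ, E2) x₀).symm y) (fderiv ℝ ν y a)

/-- The curvature `R(u, v) ξ` of the normal connection at `x`, for tangent vectors `u`, `v` and a
normal vector `ξ`, computed from the vector fields which extend `u` and `v` with constant
coordinates in the chart at `x` (their bracket is zero) and the normal field which extends `ξ`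
by orthogonal projection on the normal planes. -/
def normalCurvatureOp (F : M → Mink) (x : M) (u v : TangentSpace 𝓘(ℝ, E2) x) (ξ : Mink) : Mink :=
  let a : E2 := mfderiv 𝓘(ℝ, E2) 𝓘(ℝ, E2) (extChartAt 𝓘(ℝ, E2) x) x u
  let b : E2 := mfderiv 𝓘(ℝ, E2) 𝓘(ℝ, E2) (extChartAt 𝓘(ℝ, E2) x) x v
  let ν : E2 → Mink := fun y => normalProj F ((extChartAt 𝓘(ℝ, E2) x).symm y) ξ
  normalDeriv F x a (normalDeriv F x b ν) (extChartAt 𝓘(ℝ, E2) x x)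
    - normalDeriv F x b (normalDeriv F x a ν) (extChartAt 𝓘(ℝ, E2) x x)

/-- The pair `(n₀, n₁)` is a positively oriented orthonormal basis of the orthogonal complement of
the oriented spacelike plane with positively oriented orthonormal basis `(v, w)`: the vector `n₀` is
timelike and future directed, and `(n₀, n₁, v, w)` is positively oriented in Minkowski space. -/
structure IsNormalFrame (v w n₀ n₁ : Mink) : Prop where
  timelike : mink n₀ n₀ = -1
  spacelike : mink n₁ n₁ = 1
  orthogonal : mink n₀ n₁ = 0
  normal : mink n₀ v = 0 ∧ mink n₀ w = 0 ∧ mink n₁ v = 0 ∧ mink n₁ w = 0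
  future : 0 < n₀ 0
  oriented : 0 < (Matrix.of ![n₀, n₁, v, w]).det

theorem exists_normalFrame {v w : Mink} (h : IsSpacelikePair v w) :
    ∃ n : Mink × Mink, IsNormalFrame v w n.1 n.2 := by
  have key : ∀ a b c : Mink, ∃ d : Mink, mink d a = 0 ∧ mink d b = 0 ∧ mink d c = 0 ∧
      mink d d = -(mink a a * (mink b b * mink c c - mink b c ^ 2)
        - mink a b * (mink a b * mink c c - mink b c * mink a c)
        + mink a c * (mink a b * mink b c - mink b b * mink a c)) ∧
      (Matrix.of ![a, d, b, c]).det = mink d d := by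
    intro a b c
    refine ⟨![a 1 * (b 2 * c 3 - b 3 * c 2) - a 2 * (b 1 * c 3 - b 3 * c 1)
        + a 3 * (b 1 * c 2 - b 2 * c 1),
      a 0 * (b 2 * c 3 - b 3 * c 2) - a 2 * (b 0 * c 3 - b 3 * c 0)
        + a 3 * (b 0 * c 2 - b 2 * c 0),
      -(a 0 * (b 1 * c 3 - b 3 * c 1) - a 1 * (b 0 * c 3 - b 3 * c 0)
        + a 3 * (b 0 * c 1 - b 1 * c 0)),
      a 0 * (b 1 * c 2 - b 2 * c 1) - a 1 * (b 0 * c 2 - b 2 * c 0)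
        + a 2 * (b 0 * c 1 - b 1 * c 0)], ?_, ?_, ?_, ?_, ?_⟩
    · simp [mink]; ring
    · simp [mink]; ring
    · simp [mink]; ring
    · simp [mink]; ring
    · simp [mink, Matrix.det_succ_row_zero, Fin.sum_univ_succ, Fin.succAbove]; ring
  obtain ⟨h1, h2, h3⟩ := h
  set r : ℝ := 1 + v 0 ^ 2 + w 0 ^ 2 with hr
  have hr0 : 0 < r := by positivity
  have hs0 : 0 < Real.sqrt r := Real.sqrt_pos.2 hr0
  have hs : Real.sqrt r * Real.sqrt r = r := Real.mul_self_sqrt hr0.le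
  have hi : (Real.sqrt r)⁻¹ * (Real.sqrt r)⁻¹ * r = 1 := by
    rw [mul_assoc, inv_mul_eq_one₀ hs0.ne', eq_comm, inv_mul_eq_iff_eq_mul₀ hs0.ne', hs]
  set t : ℝ := (Real.sqrt r)⁻¹ with ht
  have ht0 : 0 < t := inv_pos.2 hs0
  let n : Mink := ![t * r, t * (v 0 * v 1 + w 0 * w 1), t * (v 0 * v 2 + w 0 * w 2),
    t * (v 0 * v 3 + w 0 * w 3)]
  have hn0 : n 0 = t * r := rfl
  have hn1 : n 1 = t * (v 0 * v 1 + w 0 * w 1) := rfl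
  have hn2 : n 2 = t * (v 0 * v 2 + w 0 * w 2) := rfl
  have hn3 : n 3 = t * (v 0 * v 3 + w 0 * w 3) := rfl
  have hnv : mink n v = 0 := by
    simp only [mink, hn0, hn1, hn2, hn3, hr] at *
    linear_combination t * v 0 * h1 + t * w 0 * h3
  have hnw : mink n w = 0 := by
    simp only [mink, hn0, hn1, hn2, hn3, hr] at *
    linear_combination t * v 0 * h3 + t * w 0 * h2
  have hnn : mink n n = -1 := by
    have : mink n n = -(t * t * r) + t * (v 0 * mink n v + w 0 * mink n w) := by
      simp only [mink, hn0, hn1, hn2, hn3, hr]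
      ring
    rw [this, hnv, hnw]
    linear_combination -hi
  obtain ⟨d, d1, d2, d3, d4, d5⟩ := key n v w
  rw [h1, h2, h3, hnn, hnv, hnw] at d4
  have d6 : mink d d = 1 := by rw [d4]; norm_num
  refine ⟨(n, d), hnn, d6, ?_, ⟨hnv, hnw, d2, d3⟩, ?_, ?_⟩
  · rw [← d1]; simp only [mink]; ring
  · show 0 < n 0
    rw [hn0]; positivity
  · show 0 < (Matrix.of ![n, d, v, w]).det
    rw [d5, d6]; norm_num

/-- A positively oriented orthonormal basis `(e₀, e₁)` of the normal plane. -/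
def normalFrame {F : M → Mink} (hF : IsIsometricImmersion F)
    (o : ∀ x : M, Orientation ℝ (TangentSpace 𝓘(ℝ, E2) x) (Fin 2)) (x : M) : Mink × Mink :=
  Classical.choose (exists_normalFrame (tangentFrame_pair hF o x))

/-- The curvature `K_N = ⟨R(e₂, e₃) e₀, e₁⟩` of the normal bundle, where `(e₀, e₁)` and
`(e₂, e₃)` are positively oriented orthonormal bases of the normal plane and of the tangent plane. -/
def normalCurvature {F : M → Mink} (hF : IsIsometricImmersion F)
    (o : ∀ x : M, Orientation ℝ (TangentSpace 𝓘(ℝ, E2) x) (Fin 2)) (x : M) : ℝ :=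
  mink (normalCurvatureOp F x (tangentFrame o x 0) (tangentFrame o x 1) (normalFrame hF o x).1)
    (normalFrame hF o x).2

end MinkowskiSurface

end

open MinkowskiSurface

/-! Complex quaternions merge the two real invariants of a pair of bivectors. By `bilinH_bivector`,
the real part of `H(a ∧ b, c ∧ d)` is the Gram pairing and its imaginary part is the volume of `(a,
b, c, d)`. The real part of the pull-back formula is therefore the Gauss equation and the imaginary
part is the Ricci equation.

Bijectivity: contracting vectors with `u₁ ∧ u₂` recovers the plane and its orientation
(`mink_contraction_eq`), and a point `a + ib` of the quadric is the bivector of a pair built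
explicitly from a unit vector along `b` orthogonal to `a`.

Pull-back formula: in a chart the immersion is a map `f` with partial derivatives `f₀, f₁`, and `G =
δ⁻¹ (f₀ ∧ f₁)`, where `δ` is the signed area of the coordinate frame (`bivector_partialD`).
Differentiating `δ⁻¹` only adds multiples of `G`, which do not contribute to the area form at `G`.
What remains is the triple product of the two partial derivatives of `f₀ ∧ f₁` with `f₀ ∧ f₁`,
computed in `mixed_derivatives`. Its real part is `det g` times the expression in second derivatives
given by `gauss_equation`. Its imaginary part is a combination of volumes, which a normal frame
turns into the right-hand side of `ricci_equation` (`vol_normalFrame`). Hence the triple product is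
`δ⁴ (K + i K_N)` (`mixed_eq_curvature`), and the powers of `δ` recombine into the area form of the
surface.

Last assertion: the complex area form is nondegenerate on the complex plane tangent to the quadric,
so it vanishes on two vectors exactly when a complex line contains both (`mixed_eq_zero_iff`). -/

namespace MinkowskiSurface

/-! ### Minkowski product; the Grassmannian and the quadric -/

theorem mink_comm (v w : Mink) : mink v w = mink w v := by
  simp only [mink]; ring

theorem mink_add_left (u v w : Mink) : mink (u + v) w = mink u w + mink v w := by
  simp only [mink, Pi.add_apply]; ring

theorem mink_smul_left (c : ℝ) (v w : Mink) : mink (c • v) w = c * mink v w := by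
  simp only [mink, Pi.smul_apply, smul_eq_mul]; ring

theorem mink_add_right (u v w : Mink) : mink u (v + w) = mink u v + mink u w := by
  simp only [mink, Pi.add_apply]; ring

theorem mink_smul_right (c : ℝ) (v w : Mink) : mink v (c • w) = c * mink v w := by
  simp only [mink, Pi.smul_apply, smul_eq_mul]; ring

/-- Contraction of a vector with a bivector, which only depends on the bivector. -/
theorem mink_contraction_eq {v w v' w' : Mink} (h : bivector v w = bivector v' w') (x : Mink) :
    mink v x • w - mink w x • v = mink v' x • w' - mink w' x • v' := by
  rw [bivector_eq, bivector_eq] at h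
  have h1 := congrArg QuaternionAlgebra.imI h
  have h2 := congrArg QuaternionAlgebra.imJ h
  have h3 := congrArg QuaternionAlgebra.imK h
  -- Real parts give the space-space components and imaginary parts the time-space ones, so all six
  -- minors `v i * w j - v j * w i` agree for the two pairs.
  rw [Complex.ext_iff] at h1 h2 h3
  simp at h1 h2 h3
  obtain ⟨a1, b1⟩ := h1
  obtain ⟨a2, b2⟩ := h2
  obtain ⟨a3, b3⟩ := h3
  ext i
  fin_cases i <;> simp [mink]
  · linear_combination -(x 1 * b1) - x 2 * b2 - x 3 * b3
  · linear_combination -(x 0 * b1) - x 2 * a3 + x 3 * a2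
  · linear_combination -(x 0 * b2) + x 1 * a3 - x 3 * a1
  · linear_combination -(x 0 * b3) - x 1 * a2 + x 2 * a1

theorem planeToQuadric_injective : Function.Injective planeToQuadric := by
  intro p q
  induction p using Quotient.inductionOn with | _ p
  induction q using Quotient.inductionOn with | _ q
  intro h
  obtain ⟨⟨v, w⟩, h1, h2, h3⟩ := p
  obtain ⟨⟨v', w'⟩, k1, k2, k3⟩ := q
  have hb : bivector v w = bivector v' w' := congrArg Subtype.val h
  dsimp only at h1 h2 h3 k1 k2 k3
  -- As `(v', w')` is orthonormal, contracting its bivector with `v'` and `w'` returns `w'` and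
  -- `-v'`. Both are thus combinations of `v` and `w`.
  have e1 := mink_contraction_eq hb v'
  have e2 := mink_contraction_eq hb w'
  rw [k1, mink_comm w' v', k3] at e1
  rw [k2, k3] at e2
  have hw : w' = mink v v' • w - mink w v' • v := by rw [e1]; simp
  have hv : v' = mink w w' • v - mink v w' • w := by
    rw [← neg_inj, neg_sub, e2]; simp
  have c1 : mink v w' = -mink w v' := by
    conv_lhs => rw [hw]
    rw [sub_eq_add_neg, ← neg_smul, mink_add_right, mink_smul_right, mink_smul_right, h3, h1]
    ring
  have c2 : mink w w' = mink v v' := by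
    conv_lhs => rw [hw]
    rw [sub_eq_add_neg, ← neg_smul, mink_add_right, mink_smul_right, mink_smul_right,
      mink_comm w v, h3, h2]
    ring
  rw [c1, c2] at hv
  generalize mink v v' = c at *
  generalize mink w v' = s at *
  have hcs : c ^ 2 + s ^ 2 = 1 := by
    rw [hv] at k1
    simp only [sub_eq_add_neg, ← neg_smul, mink_add_right, mink_smul_right, mink_add_left,
      mink_smul_left, mink_comm w v, h1, h2, h3] at k1
    linarith
  have hn : ‖(⟨c, s⟩ : ℂ)‖ = 1 := by
    rw [Complex.norm_eq_sqrt_sq_add_sq, hcs, Real.sqrt_one]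
  -- Now `v' = c v + s w` and `w' = -s v + c w` with `c² + s² = 1`; the rotation angle is the
  -- argument of `c + i s`.
  refine Quotient.sound (s := planeSetoid) ⟨Complex.arg ⟨c, s⟩, ?_, ?_⟩
  · rw [Complex.cos_arg (by rw [← norm_ne_zero_iff, hn]; simp), Complex.sin_arg, hn]
    simpa [sub_eq_add_neg, ← neg_smul] using hv
  · rw [Complex.cos_arg (by rw [← norm_ne_zero_iff, hn]; simp), Complex.sin_arg, hn]
    simp only [div_one]
    rw [hw]
    module

/-- Every vector of Euclidean space has a unit orthogonal vector. -/
theorem exists_unit_orthogonal (a b c : ℝ) :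
    ∃ x y z : ℝ, x ^ 2 + y ^ 2 + z ^ 2 = 1 ∧ a * x + b * y + c * z = 0 := by
  by_cases hc : a = 0 ∧ b = 0
  · exact ⟨1, 0, 0, by norm_num, by simp [hc.1]⟩
  · have hp : 0 < a ^ 2 + b ^ 2 := by
      rcases not_and_or.1 hc with h0 | h0
      · have := sq_pos_of_ne_zero h0; positivity
      · have := sq_pos_of_ne_zero h0; positivity
    have hs := Real.sqrt_pos.2 hp
    have hq := Real.sq_sqrt hp.le
    refine ⟨b / √(a ^ 2 + b ^ 2), -a / √(a ^ 2 + b ^ 2), 0, ?_, ?_⟩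
    · field_simp
      linarith
    · field_simp
      ring

theorem planeToQuadric_surjective : Function.Surjective planeToQuadric := by
  rintro ⟨Z, hZ0, hZ⟩
  set a1 := Z.imI.re with ha1
  set b1 := Z.imI.im with hb1
  set a2 := Z.imJ.re with ha2
  set b2 := Z.imJ.im with hb2
  set a3 := Z.imK.re with ha3
  set b3 := Z.imK.im with hb3
  have hre : a1 ^ 2 + a2 ^ 2 + a3 ^ 2 = 1 + (b1 ^ 2 + b2 ^ 2 + b3 ^ 2) := by
    have := congrArg Complex.re hZ
    simp [pow_two] at this
    linarith
  have him : a1 * b1 + a2 * b2 + a3 * b3 = 0 := by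
    have := congrArg Complex.im hZ
    simp [pow_two] at this
    linarith
  -- A unit vector `n = (x, y, z)` orthogonal to `a` with `b = t n`. If `b = 0` any unit vector
  -- orthogonal to `a` serves; otherwise `n = b / |b|`, orthogonal to `a` by `him`.
  obtain ⟨t, x, y, z, hx, hax, hbx, hby, hbz⟩ : ∃ t x y z : ℝ, x ^ 2 + y ^ 2 + z ^ 2 = 1 ∧
      a1 * x + a2 * y + a3 * z = 0 ∧ b1 = t * x ∧ b2 = t * y ∧ b3 = t * z := by
    by_cases hb : b1 ^ 2 + b2 ^ 2 + b3 ^ 2 = 0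
    · obtain ⟨x, y, z, h1, h2⟩ := exists_unit_orthogonal a1 a2 a3
      refine ⟨0, x, y, z, h1, h2, ?_, ?_, ?_⟩ <;> nlinarith [sq_nonneg b1, sq_nonneg b2, sq_nonneg b3]
    · have hp : 0 < b1 ^ 2 + b2 ^ 2 + b3 ^ 2 := lt_of_le_of_ne (by positivity) (Ne.symm hb)
      have hs := Real.sqrt_pos.2 hp
      have hq := Real.sq_sqrt hp.le
      generalize √(b1 ^ 2 + b2 ^ 2 + b3 ^ 2) = r at *
      refine ⟨r, b1 / r, b2 / r, b3 / r, ?_, ?_, ?_, ?_, ?_⟩ <;> field_simp <;> linarith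
  have hb : b1 ^ 2 + b2 ^ 2 + b3 ^ 2 = t ^ 2 := by
    rw [hbx, hby, hbz]; linear_combination t ^ 2 * hx
  -- The pair is `v = (t, n × a)`, `w = (0, n)`. The real part of `v ∧ w` is `(n × a) × n = a` and
  -- its imaginary part is `t n = b`; moreover `⟨v, v⟩ = |a|² - |b|² = 1`.
  refine ⟨Quotient.mk planeSetoid ⟨(![t, y * a3 - z * a2, z * a1 - x * a3, x * a2 - y * a1],
    ![0, x, y, z]), ?_, ?_, ?_⟩, ?_⟩
  · simp [mink]
    linear_combination hre + hb + (a1 ^ 2 + a2 ^ 2 + a3 ^ 2) * hx -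
      (a1 * x + a2 * y + a3 * z) * hax
  · simp [mink]
    linear_combination hx
  · simp [mink]
    ring
  · refine Subtype.ext ?_
    show bivector _ _ = Z
    rw [bivector_eq]
    ext
    · simp [hZ0]
    · apply Complex.ext
      · simp [← ha1]
        linear_combination a1 * hx - x * hax
      · simp [← hb1, hbx]
    · apply Complex.ext
      · simp [← ha2]
        linear_combination a2 * hx - y * hax
      · simp [← hb2, hby]
    · apply Complex.ext
      · simp [← ha3]
        linear_combination a3 * hx - z * hax
      · simp [← hb3, hbz]

/-! ### Components and products of bivectors -/

theorem bivector_re (v w : Mink) : (bivector v w).re = 0 := by rw [bivector_eq]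

theorem bivector_imI (v w : Mink) : (bivector v w).imI =
    (v 2 * w 3 - v 3 * w 2 : ℂ) + Complex.I * (v 0 * w 1 - v 1 * w 0) := by rw [bivector_eq]

theorem bivector_imJ (v w : Mink) : (bivector v w).imJ =
    (v 3 * w 1 - v 1 * w 3 : ℂ) + Complex.I * (v 0 * w 2 - v 2 * w 0) := by rw [bivector_eq]

theorem bivector_imK (v w : Mink) : (bivector v w).imK =
    (v 1 * w 2 - v 2 * w 1 : ℂ) + Complex.I * (v 0 * w 3 - v 3 * w 0) := by rw [bivector_eq]

theorem bivector_add_left (u v w : Mink) : bivector (u + v) w = bivector u w + bivector v w := by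
  ext <;> simp [bivector_re, bivector_imI, bivector_imJ, bivector_imK] <;> ring

theorem bivector_smul_left (c : ℝ) (v w : Mink) :
    bivector (c • v) w = (c : ℂ) • bivector v w := by
  ext <;> simp [bivector_re, bivector_imI, bivector_imJ, bivector_imK] <;> ring

theorem bivector_add_right (u v w : Mink) : bivector u (v + w) = bivector u v + bivector u w := by
  ext <;> simp [bivector_re, bivector_imI, bivector_imJ, bivector_imK] <;> ring

theorem bivector_smul_right (c : ℝ) (v w : Mink) :
    bivector v (c • w) = (c : ℂ) • bivector v w := by
  ext <;> simp [bivector_re, bivector_imI, bivector_imJ, bivector_imK] <;> ring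

/-- The determinant of four vectors of Minkowski space. -/
noncomputable def vol (a b c d : Mink) : ℝ := (Matrix.of ![a, b, c, d]).det

theorem vol_eq (a b c d : Mink) : vol a b c d =
    a 0 * (b 1 * (c 2 * d 3 - c 3 * d 2) - b 2 * (c 1 * d 3 - c 3 * d 1)
      + b 3 * (c 1 * d 2 - c 2 * d 1))
    - a 1 * (b 0 * (c 2 * d 3 - c 3 * d 2) - b 2 * (c 0 * d 3 - c 3 * d 0)
      + b 3 * (c 0 * d 2 - c 2 * d 0))
    + a 2 * (b 0 * (c 1 * d 3 - c 3 * d 1) - b 1 * (c 0 * d 3 - c 3 * d 0)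
      + b 3 * (c 0 * d 1 - c 1 * d 0))
    - a 3 * (b 0 * (c 1 * d 2 - c 2 * d 1) - b 1 * (c 0 * d 2 - c 2 * d 0)
      + b 2 * (c 0 * d 1 - c 1 * d 0)) := by
  simp [vol, Matrix.det_succ_row_zero, Fin.sum_univ_succ, Fin.succAbove]
  ring

theorem mixed_eq (p q r : ℍ[ℂ]) (h : r.re = 0) : mixed p q r =
    (p.imJ * q.imK - p.imK * q.imJ) * r.imI + (p.imK * q.imI - p.imI * q.imK) * r.imJ
      + (p.imI * q.imJ - p.imJ * q.imI) * r.imK := by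
  simp [mixed, bilinH, cross, h]
  ring

theorem bilinH_bivector (a b c d : Mink) : bilinH (bivector a b) (bivector c d) =
    (mink a c * mink b d - mink a d * mink b c : ℝ) + Complex.I * (vol a b c d : ℝ) := by
  rw [vol_eq]
  apply Complex.ext <;>
    simp [bilinH, mink, bivector_re, bivector_imI, bivector_imJ, bivector_imK] <;> ring

/-- The commutator of two bivectors contracts one factor of each. With `bilinH_bivector`, this makes
triple products of bivectors computable from scalar products and volumes alone. -/
theorem cross_bivector (a b c d : Mink) : cross (bivector a b) (bivector c d) =
    (mink b d : ℂ) • bivector a c + (mink a c : ℂ) • bivector b d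
      - (mink b c : ℂ) • bivector a d - (mink a d : ℂ) • bivector b c := by
  ext <;> apply Complex.ext <;>
    simp [cross, mink, bivector_re, bivector_imI, bivector_imJ, bivector_imK] <;> ring


/-! ### Algebra of frames and bivectors -/

theorem cross_add_left (p q r : ℍ[ℂ]) : cross (p + q) r = cross p r + cross q r := by
  simp only [cross, add_mul, mul_add]; module

theorem cross_add_right (p q r : ℍ[ℂ]) : cross p (q + r) = cross p q + cross p r := by
  simp only [cross, add_mul, mul_add]; module

theorem bilinH_add_left (p q r : ℍ[ℂ]) : bilinH (p + q) r = bilinH p r + bilinH q r := by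
  simp [bilinH]; ring

theorem bilinH_sub_left (p q r : ℍ[ℂ]) : bilinH (p - q) r = bilinH p r - bilinH q r := by
  simp [bilinH]; ring

theorem bilinH_smul_left (c : ℂ) (p r : ℍ[ℂ]) : bilinH (c • p) r = c * bilinH p r := by
  simp [bilinH]; ring

theorem vol_self_fst (a b c : Mink) : vol a a b c = 0 := by rw [vol_eq]; ring

theorem vol_fst_eq_thd (a b c : Mink) : vol a b a c = 0 := by rw [vol_eq]; ring

theorem vol_fst_eq_fth (a b c : Mink) : vol a b c a = 0 := by rw [vol_eq]; ring

theorem vol_snd_eq_thd (a b c : Mink) : vol a b b c = 0 := by rw [vol_eq]; ring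

theorem vol_snd_eq_fth (a b c : Mink) : vol a b c b = 0 := by rw [vol_eq]; ring

/-- The triple product of `P = u ∧ w` with its derivatives `a ∧ w + u ∧ b` and `b ∧ w + u ∧ c`. -/
theorem mixed_derivatives (u w a b c : Mink) :
    mixed (bivector a w + bivector u b) (bivector b w + bivector u c) (bivector u w) =
      (((mink u u * mink w w - mink u w ^ 2) * (mink a c - mink b b)
        - (mink a u * (mink w w * mink c u - mink u w * mink c w)
          + mink a w * (mink u u * mink c w - mink u w * mink c u))
        + (mink b u * (mink w w * mink b u - mink u w * mink b w)
          + mink b w * (mink u u * mink b w - mink u w * mink b u)) : ℝ) : ℂ)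
      + Complex.I * ((mink w w * vol a b u w - mink u w * vol a c u w
          + mink u u * vol b c u w : ℝ) : ℂ) := by
  simp only [mixed, cross_add_left, cross_add_right, cross_bivector, bilinH_add_left,
    bilinH_sub_left, bilinH_smul_left, bilinH_bivector, vol_self_fst, vol_fst_eq_thd,
    vol_fst_eq_fth, vol_snd_eq_thd, vol_snd_eq_fth, mink_comm w u, mink_comm u b,
    mink_comm u c, mink_comm w b, mink_comm w c]
  push_cast
  ring

open Matrix in
-- The Gram matrix factors as `A · diag(-1, 1, 1, 1) · A'ᵀ`; the sign is the determinant of the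
-- metric.
theorem vol_mul_vol (a b c d a' b' c' d' : Mink) :
    vol a b c d * vol a' b' c' d' =
      -(Matrix.of fun i j => mink (![a, b, c, d] i) (![a', b', c', d'] j)).det := by
  have h : (Matrix.of fun i j => mink (![a, b, c, d] i) (![a', b', c', d'] j)) =
      Matrix.of ![a, b, c, d] * Matrix.diagonal ![-1, 1, 1, 1] *
        (Matrix.of ![a', b', c', d'])ᵀ := by
    ext i j
    rw [Matrix.mul_apply]
    simp [Matrix.mul_diagonal, Fin.sum_univ_four, mink]
  rw [h, Matrix.det_mul, Matrix.det_mul, Matrix.det_transpose, Matrix.det_diagonal]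
  simp [Fin.prod_univ_four, vol]

/-- The volume of two vectors and a basis of a spacelike plane, in terms of a normal frame. -/
theorem vol_normalFrame {v w n₀ n₁ : Mink} (hp : IsSpacelikePair v w)
    (hn : IsNormalFrame v w n₀ n₁) (x y : Mink) (p q r s : ℝ) :
    vol x y (p • v + q • w) (r • v + s • w) =
      (p * s - q * r) * (mink x n₁ * mink y n₀ - mink x n₀ * mink y n₁) := by
  obtain ⟨h1, h2, h3⟩ := hp
  obtain ⟨k1, k2, k3, ⟨k4, k5, k6, k7⟩, -, ho⟩ := hn
  -- The Gram determinant of an orthonormal frame is `-1`, so the volume squares to `1`; the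
  -- orientation selects the positive root.
  have hv : vol n₀ n₁ v w = 1 := by
    have h := vol_mul_vol n₀ n₁ v w n₀ n₁ v w
    simp [Matrix.det_succ_row_zero, Fin.sum_univ_succ, Fin.succAbove, h1, h2, h3, k1, k2, k3, k4,
      k5, k6, k7, mink_comm v n₀, mink_comm w n₀, mink_comm v n₁, mink_comm w n₁,
      mink_comm n₁ n₀, mink_comm w v] at h
    have ho' : 0 < vol n₀ n₁ v w := ho
    nlinarith
  -- Paired with the frame, the last two vectors have no normal components, so the Gram matrix is
  -- block triangular and its determinant splits into two `2 × 2` minors.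
  have h := vol_mul_vol x y (p • v + q • w) (r • v + s • w) n₀ n₁ v w
  rw [hv, mul_one] at h
  rw [h]
  simp [Matrix.det_succ_row_zero, Fin.sum_univ_succ, Fin.succAbove, mink_add_left,
      mink_smul_left, h1, h2, h3, k4,
      k5, k6, k7, mink_comm v n₀, mink_comm w n₀, mink_comm v n₁, mink_comm w n₁,
      mink_comm w v]
  ring

/-! ### Partial derivatives -/

section Partial

variable {V W X : Type*} [NormedAddCommGroup V] [NormedSpace ℝ V] [NormedAddCommGroup W]
  [NormedSpace ℝ W] [NormedAddCommGroup X] [NormedSpace ℝ X]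

/-- The directional derivative of a vector-valued function. -/
noncomputable def dirD (a : E2) (f : E2 → V) (y : E2) : V := fderiv ℝ f y a

theorem contDiffOn_dirD {f : E2 → V} {U : Set E2} (hU : IsOpen U)
    (hf : ContDiffOn ℝ ∞ f U) (a : E2) : ContDiffOn ℝ ∞ (dirD a f) U :=
  (hf.fderiv_of_isOpen hU (by simp)).clm_apply contDiffOn_const

theorem differentiableAt_of_contDiffOn {f : E2 → V} {U : Set E2} (hU : IsOpen U)
    (hf : ContDiffOn ℝ ∞ f U) {y : E2} (hy : y ∈ U) : DifferentiableAt ℝ f y :=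
  (hf.contDiffAt (hU.mem_nhds hy)).differentiableAt (by simp)

theorem dirD_comm {f : E2 → V} {U : Set E2} (hU : IsOpen U)
    (hf : ContDiffOn ℝ ∞ f U) {y : E2} (hy : y ∈ U) (a b : E2) :
    dirD a (dirD b f) y = dirD b (dirD a f) y := by
  have h2 : ContDiffOn ℝ ∞ (fderiv ℝ f) U := hf.fderiv_of_isOpen hU (by simp)
  have hd := differentiableAt_of_contDiffOn hU h2 hy
  have key (a b : E2) : dirD a (dirD b f) y =
      fderiv ℝ (fderiv ℝ f) y a b := by
    unfold dirD
    rw [fderiv_clm_apply hd (differentiableAt_const _)]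
    simp
  rw [key, key]
  exact ((hf.contDiffAt (hU.mem_nhds hy)).isSymmSndFDerivAt
    (by rw [minSmoothness_of_isRCLikeNormedField]; exact WithTop.coe_le_coe.2 (le_top : (2 : ℕ∞) ≤ ⊤))).eq _ _

theorem dirD_congr {f g : E2 → V} {U : Set E2} (hU : IsOpen U) (h : ∀ y ∈ U, f y = g y)
    {y : E2} (hy : y ∈ U) (a : E2) : dirD a f y = dirD a g y := by
  unfold dirD
  rw [Filter.EventuallyEq.fderiv_eq (Filter.eventuallyEq_of_mem (hU.mem_nhds hy) h)]

theorem dirD_bilin (B : V →L[ℝ] W →L[ℝ] X) {u : E2 → V} {w : E2 → W} {y : E2}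
    (hu : DifferentiableAt ℝ u y) (hw : DifferentiableAt ℝ w y) (a : E2) :
    dirD a (fun z => B (u z) (w z)) y =
      B (dirD a u y) (w y) + B (u y) (dirD a w y) := by
  unfold dirD
  rw [B.fderiv_of_bilinear hu hw]
  simp [add_comm]

theorem dirD_add {u w : E2 → V} {y : E2} (hu : DifferentiableAt ℝ u y)
    (hw : DifferentiableAt ℝ w y) (a : E2) :
    dirD a (fun z => u z + w z) y = dirD a u y + dirD a w y := by
  unfold dirD
  rw [fderiv_fun_add hu hw]
  simp

theorem dirD_smul {c : E2 → ℝ} {u : E2 → V} {y : E2} (hc : DifferentiableAt ℝ c y)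
    (hu : DifferentiableAt ℝ u y) (a : E2) :
    dirD a (fun z => c z • u z) y = c y • dirD a u y + dirD a c y • u y := by
  unfold dirD
  rw [fderiv_fun_smul hc hu]
  simp

/-- The partial derivative in the `i`-th coordinate direction of a vector-valued function. -/
noncomputable def partialD (i : Fin 2) (f : E2 → V) (y : E2) : V :=
  dirD (EuclideanSpace.single i (1 : ℝ)) f y

theorem pd_eq_partialD (i : Fin 2) (f : E2 → ℝ) : pd i f = partialD i f := rfl

theorem dirD_eq_sum (a : E2) (f : E2 → V) (y : E2) :
    dirD a f y = a 0 • partialD 0 f y + a 1 • partialD 1 f y := by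
  have h : a = a 0 • EuclideanSpace.single (0 : Fin 2) (1 : ℝ) +
      a 1 • EuclideanSpace.single (1 : Fin 2) (1 : ℝ) := by
    ext i
    fin_cases i <;> simp
  unfold partialD dirD
  conv_lhs => rw [h]
  rw [map_add, map_smul, map_smul]

theorem contDiffOn_partialD {f : E2 → V} {U : Set E2} (hU : IsOpen U)
    (hf : ContDiffOn ℝ ∞ f U) (i : Fin 2) : ContDiffOn ℝ ∞ (partialD i f) U :=
  contDiffOn_dirD hU hf _

theorem partialD_comm {f : E2 → V} {U : Set E2} (hU : IsOpen U)
    (hf : ContDiffOn ℝ ∞ f U) {y : E2} (hy : y ∈ U) (i j : Fin 2) :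
    partialD i (partialD j f) y = partialD j (partialD i f) y :=
  dirD_comm hU hf hy _ _

theorem partialD_congr {f g : E2 → V} {U : Set E2} (hU : IsOpen U) (h : ∀ y ∈ U, f y = g y)
    {y : E2} (hy : y ∈ U) (i : Fin 2) : partialD i f y = partialD i g y :=
  dirD_congr hU h hy _

theorem partialD_add {u w : E2 → V} {y : E2} (hu : DifferentiableAt ℝ u y)
    (hw : DifferentiableAt ℝ w y) (i : Fin 2) :
    partialD i (fun z => u z + w z) y = partialD i u y + partialD i w y :=
  dirD_add hu hw _

theorem partialD_mul {c u : E2 → ℝ} {y : E2} (hc : DifferentiableAt ℝ c y)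
    (hu : DifferentiableAt ℝ u y) (i : Fin 2) :
    partialD i (fun z => c z * u z) y = c y * partialD i u y + partialD i c y * u y :=
  dirD_smul hc hu _

end Partial

/-- The Minkowski metric as a continuous bilinear map. -/
noncomputable def minkCLM : Mink →L[ℝ] Mink →L[ℝ] ℝ :=
  (LinearMap.mk₂ ℝ mink mink_add_left mink_smul_left mink_add_right
    mink_smul_right).toContinuousBilinearMap

theorem dirD_mink {u w : E2 → Mink} {y : E2} (hu : DifferentiableAt ℝ u y)
    (hw : DifferentiableAt ℝ w y) (a : E2) :
    dirD a (fun z => mink (u z) (w z)) y =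
      mink (dirD a u y) (w y) + mink (u y) (dirD a w y) :=
  dirD_bilin minkCLM hu hw a

theorem partialD_mink {u w : E2 → Mink} {y : E2} (hu : DifferentiableAt ℝ u y)
    (hw : DifferentiableAt ℝ w y) (i : Fin 2) :
    partialD i (fun z => mink (u z) (w z)) y =
      mink (partialD i u y) (w y) + mink (u y) (partialD i w y) :=
  dirD_mink hu hw _

theorem contDiffOn_mink {u w : E2 → Mink} {U : Set E2} (hu : ContDiffOn ℝ ∞ u U)
    (hw : ContDiffOn ℝ ∞ w U) : ContDiffOn ℝ ∞ (fun z => mink (u z) (w z)) U :=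
  (minkCLM.contDiff.comp_contDiffOn hu).clm_apply hw

/-! ### The Gauss equation of a parametrized surface -/

/-- The metric induced by a parametrized surface. -/
noncomputable def inducedMetric (f : E2 → Mink) (y : E2) : Matrix (Fin 2) (Fin 2) ℝ :=
  Matrix.of fun i j => mink (partialD i f y) (partialD j f y)

theorem inducedMetric_apply (f : E2 → Mink) (y : E2) (i j : Fin 2) :
    inducedMetric f y i j = mink (partialD i f y) (partialD j f y) := rfl

theorem inducedMetric_det (f : E2 → Mink) (y : E2) : (inducedMetric f y).det =
    mink (partialD 0 f y) (partialD 0 f y) * mink (partialD 1 f y) (partialD 1 f y)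
      - mink (partialD 0 f y) (partialD 1 f y) ^ 2 := by
  rw [Matrix.det_fin_two]
  simp only [inducedMetric_apply, mink_comm (partialD 1 f y) (partialD 0 f y)]
  ring

/-- The second derivatives in terms of the metric: the coefficients of the tangent part. -/
noncomputable def inducedChristoffel (f : E2 → Mink) (k i j : Fin 2) (y : E2) : ℝ :=
  ∑ l, (inducedMetric f y)⁻¹ k l * mink (partialD i (partialD j f) y) (partialD l f y)

variable {f : E2 → Mink} {U : Set E2}

theorem contDiffOn_inducedMetric (hU : IsOpen U) (hf : ContDiffOn ℝ ∞ f U) (i j : Fin 2) :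
    ContDiffOn ℝ ∞ (fun y => inducedMetric f y i j) U :=
  contDiffOn_mink (contDiffOn_partialD hU hf i) (contDiffOn_partialD hU hf j)

theorem contDiffOn_inducedMetric_det (hU : IsOpen U) (hf : ContDiffOn ℝ ∞ f U) :
    ContDiffOn ℝ ∞ (fun y => (inducedMetric f y).det) U := by
  simp only [Matrix.det_fin_two]
  have h := contDiffOn_inducedMetric hU hf
  exact ((h 0 0).mul (h 1 1)).sub ((h 0 1).mul (h 1 0))

theorem contDiffOn_inducedMetric_inv (hU : IsOpen U) (hf : ContDiffOn ℝ ∞ f U)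
    (hD : ∀ y ∈ U, (inducedMetric f y).det ≠ 0) (i j : Fin 2) :
    ContDiffOn ℝ ∞ (fun y => (inducedMetric f y)⁻¹ i j) U := by
  simp only [Matrix.inv_def, Ring.inverse_eq_inv', Matrix.smul_apply, smul_eq_mul,
    Matrix.adjugate_fin_two]
  refine ((contDiffOn_inducedMetric_det hU hf).inv hD).mul ?_
  have h := contDiffOn_inducedMetric hU hf
  fin_cases i <;> fin_cases j
  · exact h 1 1
  · exact (h 0 1).neg
  · exact (h 1 0).neg
  · exact h 0 0

theorem contDiffOn_inducedChristoffel (hU : IsOpen U) (hf : ContDiffOn ℝ ∞ f U)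
    (hD : ∀ y ∈ U, (inducedMetric f y).det ≠ 0) (k i j : Fin 2) :
    ContDiffOn ℝ ∞ (inducedChristoffel f k i j) U := by
  unfold inducedChristoffel
  refine ContDiffOn.sum fun l _ => (contDiffOn_inducedMetric_inv hU hf hD k l).mul ?_
  exact contDiffOn_mink (contDiffOn_partialD hU (contDiffOn_partialD hU hf j) i)
    (contDiffOn_partialD hU hf l)

theorem sum_inducedMetric_mul_inv {y : E2} (hD : (inducedMetric f y).det ≠ 0) (a : Fin 2 → ℝ)
    (k : Fin 2) :
    ∑ l, inducedMetric f y k l * ∑ m, (inducedMetric f y)⁻¹ l m * a m = a k := by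
  have h : inducedMetric f y * (inducedMetric f y)⁻¹ = 1 :=
    Matrix.mul_nonsing_inv _ (isUnit_iff_ne_zero.2 hD)
  have : (inducedMetric f y).mulVec ((inducedMetric f y)⁻¹.mulVec a) k = a k := by
    rw [Matrix.mulVec_mulVec, h, Matrix.one_mulVec]
  exact this

theorem sum_inducedMetric_mul_inducedChristoffel {y : E2}
    (hD : (inducedMetric f y).det ≠ 0) (k i j : Fin 2) :
    ∑ l, inducedMetric f y k l * inducedChristoffel f l i j y =
      mink (partialD i (partialD j f) y) (partialD k f y) :=
  sum_inducedMetric_mul_inv hD (fun l => mink (partialD i (partialD j f) y) (partialD l f y)) k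

/-- The lowered derivative of the Christoffel symbols. -/
theorem sum_inducedMetric_mul_partialD_inducedChristoffel (hU : IsOpen U)
    (hf : ContDiffOn ℝ ∞ f U) (hD : ∀ y ∈ U, (inducedMetric f y).det ≠ 0) {y : E2} (hy : y ∈ U)
    (m k i j : Fin 2) :
    ∑ l, inducedMetric f y k l * partialD m (inducedChristoffel f l i j) y =
      mink (partialD m (partialD i (partialD j f)) y) (partialD k f y)
      + mink (partialD i (partialD j f) y) (partialD m (partialD k f) y)
      - ∑ l, (mink (partialD m (partialD k f) y) (partialD l f y)
          + mink (partialD k f y) (partialD m (partialD l f) y)) *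
            inducedChristoffel f l i j y := by
  have hd {V : Type} [NormedAddCommGroup V] [NormedSpace ℝ V] {g : E2 → V}
      (hg : ContDiffOn ℝ ∞ g U) := differentiableAt_of_contDiffOn hU hg hy
  have hp := contDiffOn_partialD hU hf
  -- Differentiating the lowered identity `∑ g_kl Γ^l_ij = ⟨∂_i ∂_j f, ∂_k f⟩` avoids any derivative
  -- of the inverse metric.
  have h := partialD_congr hU
    (fun z hz => sum_inducedMetric_mul_inducedChristoffel (hD z hz) k i j) hy m
  have hg := contDiffOn_inducedMetric hU hf
  have hc := contDiffOn_inducedChristoffel hU hf hD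
  have hgd (l : Fin 2) : partialD m (fun z => inducedMetric f z k l) y =
      mink (partialD m (partialD k f) y) (partialD l f y)
          + mink (partialD k f y) (partialD m (partialD l f) y) :=
    partialD_mink (hd (hp k)) (hd (hp l)) m
  simp only [Fin.sum_univ_two] at h ⊢
  rw [partialD_mink (hd (contDiffOn_partialD hU (hp j) i)) (hd (hp k)),
    partialD_add (hd ((hg k 0).mul (hc 0 i j))) (hd ((hg k 1).mul (hc 1 i j))),
    partialD_mul (hd (hg k 0)) (hd (hc 0 i j)),
    partialD_mul (hd (hg k 1)) (hd (hc 1 i j)), hgd, hgd] at h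
  linear_combination h

/-- The Gauss equation. -/
theorem gauss_equation (hU : IsOpen U)
    (hf : ContDiffOn ℝ ∞ f U) (hD : ∀ y ∈ U, (inducedMetric f y).det ≠ 0) {y : E2} (hy : y ∈ U) :
    ∑ l, inducedMetric f y 0 l * (partialD 0 (inducedChristoffel f l 1 1) y
      - partialD 1 (inducedChristoffel f l 0 1) y
      + ∑ m, (inducedChristoffel f l 0 m y * inducedChristoffel f m 1 1 y
        - inducedChristoffel f l 1 m y * inducedChristoffel f m 0 1 y)) =
      mink (partialD 0 (partialD 0 f) y) (partialD 1 (partialD 1 f) y)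
      - mink (partialD 0 (partialD 1 f) y) (partialD 0 (partialD 1 f) y)
      - ∑ l, mink (partialD 0 (partialD 0 f) y) (partialD l f y) * inducedChristoffel f l 1 1 y
      + ∑ l, mink (partialD 0 (partialD 1 f) y) (partialD l f y) *
          inducedChristoffel f l 0 1 y := by
  have h0 := sum_inducedMetric_mul_partialD_inducedChristoffel hU hf hD hy 0 0 1 1
  have h1 := sum_inducedMetric_mul_partialD_inducedChristoffel hU hf hD hy 1 0 0 1
  have e (i j : Fin 2) := sum_inducedMetric_mul_inducedChristoffel (hD y hy) 0 i j
  have e00 := e 0 0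
  have e01 := e 0 1
  have e10 := e 1 0
  have e11 := e 1 1
  have s : partialD 1 (partialD 0 f) y = partialD 0 (partialD 1 f) y :=
    partialD_comm hU hf hy 1 0
  -- The third derivatives in `h0` and `h1` coincide and cancel in the difference.
  have t : partialD 1 (partialD 0 (partialD 1 f)) y = partialD 0 (partialD 1 (partialD 1 f)) y :=
    partialD_comm hU (contDiffOn_partialD hU hf 1) hy 1 0
  simp only [Fin.sum_univ_two] at *
  rw [s] at h1 e10
  rw [t] at h1
  rw [mink_comm (partialD 1 (partialD 1 f) y)] at h0
  simp only [mink_comm (partialD 0 f y) (partialD 0 (partialD 0 f) y),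
    mink_comm (partialD 0 f y) (partialD 0 (partialD 1 f) y),
    mink_comm (partialD 0 f y) (partialD 1 (partialD 1 f) y)] at *
  linear_combination h0 - h1 + inducedChristoffel f 0 1 1 y * e00
    + inducedChristoffel f 1 1 1 y * e01 - inducedChristoffel f 0 0 1 y * e10
    - inducedChristoffel f 1 0 1 y * e11


end MinkowskiSurface

namespace MinkowskiSurface

/-! ### The Ricci equation of a parametrized surface -/

variable {f : E2 → Mink} {U : Set E2}

/-- The orthogonal projection on the normal planes of a parametrized surface. -/
noncomputable def inducedProj (f : E2 → Mink) (y : E2) (v : Mink) : Mink :=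
  v - ∑ k, (∑ l, (inducedMetric f y)⁻¹ k l * mink v (partialD l f y)) • partialD k f y

theorem mink_sub_left (u v w : Mink) : mink (u - v) w = mink u w - mink v w := by
  simp only [mink, Pi.sub_apply]; ring

theorem mink_inducedProj (y : E2) (v n : Mink) : mink (inducedProj f y v) n =
    mink v n - ∑ k, (∑ l, (inducedMetric f y)⁻¹ k l * mink v (partialD l f y)) *
      mink (partialD k f y) n := by
  simp only [inducedProj, Fin.sum_univ_two, mink_sub_left, mink_add_left, mink_smul_left]

theorem mink_inducedProj_tangent {y : E2} (hD : (inducedMetric f y).det ≠ 0) (v : Mink)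
    (j : Fin 2) : mink (inducedProj f y v) (partialD j f y) = 0 := by
  rw [mink_inducedProj]
  have h := sum_inducedMetric_mul_inv hD (fun l => mink v (partialD l f y)) j
  rw [sub_eq_zero, ← h]
  refine Finset.sum_congr rfl fun k _ => ?_
  rw [inducedMetric_apply, mink_comm, mul_comm]

theorem mink_inducedProj_normal {y : E2} {n : Mink} (hn : ∀ k, mink n (partialD k f y) = 0)
    (v : Mink) : mink (inducedProj f y v) n = mink v n := by
  rw [mink_inducedProj]
  simp [mink_comm _ n, hn]

theorem inducedProj_of_normal {y : E2} {n : Mink} (hn : ∀ k, mink n (partialD k f y) = 0) :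
    inducedProj f y n = n := by
  simp [inducedProj, hn]

theorem contDiffOn_inducedProj (hU : IsOpen U) (hf : ContDiffOn ℝ ∞ f U)
    (hD : ∀ y ∈ U, (inducedMetric f y).det ≠ 0) {w : E2 → Mink} (hw : ContDiffOn ℝ ∞ w U) :
    ContDiffOn ℝ ∞ (fun y => inducedProj f y (w y)) U := by
  unfold inducedProj
  refine hw.sub (ContDiffOn.sum fun k _ => ?_)
  have h : ContDiffOn ℝ ∞
      (fun y => ∑ l, (inducedMetric f y)⁻¹ k l * mink (w y) (partialD l f y)) U :=
    ContDiffOn.sum fun l _ => (contDiffOn_inducedMetric_inv hU hf hD k l).mul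
      (contDiffOn_mink hw (contDiffOn_partialD hU hf l))
  exact h.smul (contDiffOn_partialD hU hf k)

/-- The coefficients of the tangent part of the derivative of a normal field. -/
noncomputable def shapeCoeff (f : E2 → Mink) (ν : E2 → Mink) (a : E2) (k : Fin 2) (y : E2) : ℝ :=
  ∑ l, (inducedMetric f y)⁻¹ k l * mink (ν y) (dirD a (partialD l f) y)

theorem contDiffOn_shapeCoeff (hU : IsOpen U) (hf : ContDiffOn ℝ ∞ f U)
    (hD : ∀ y ∈ U, (inducedMetric f y).det ≠ 0) {ν : E2 → Mink} (hν : ContDiffOn ℝ ∞ ν U)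
    (a : E2) (k : Fin 2) : ContDiffOn ℝ ∞ (shapeCoeff f ν a k) U :=
  ContDiffOn.sum fun l _ => (contDiffOn_inducedMetric_inv hU hf hD k l).mul
    (contDiffOn_mink hν (contDiffOn_dirD hU (contDiffOn_partialD hU hf l) a))

/-- The Weingarten formula. -/
theorem inducedProj_dirD (hU : IsOpen U) (hf : ContDiffOn ℝ ∞ f U) {ν : E2 → Mink}
    (hν : ContDiffOn ℝ ∞ ν U) (hn : ∀ z ∈ U, ∀ k, mink (ν z) (partialD k f z) = 0)
    (a : E2) {y : E2} (hy : y ∈ U) :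
    inducedProj f y (dirD a ν y) =
      dirD a ν y + (shapeCoeff f ν a 0 y • partialD 0 f y +
        shapeCoeff f ν a 1 y • partialD 1 f y) := by
  -- Derivative of the normality condition `⟨ν, ∂_l f⟩ = 0`.
  have h (l : Fin 2) : mink (dirD a ν y) (partialD l f y) =
      -mink (ν y) (dirD a (partialD l f) y) := by
    have h1 := dirD_mink (differentiableAt_of_contDiffOn hU hν hy)
      (differentiableAt_of_contDiffOn hU (contDiffOn_partialD hU hf l) hy) a
    rw [dirD_congr hU (fun z hz => hn z hz l) hy] at h1
    have h2 : dirD a (fun _ : E2 => (0 : ℝ)) y = 0 := by simp [dirD]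
    linarith
  simp only [inducedProj, shapeCoeff, h, Fin.sum_univ_two]
  module

/-- The Weingarten formula is differentiated once more. The derivatives of the shape coefficients
multiply tangent vectors, so they disappear against the normal vector `n`. -/
theorem mink_dirD_inducedProj_dirD (hU : IsOpen U) (hf : ContDiffOn ℝ ∞ f U)
    (hD : ∀ y ∈ U, (inducedMetric f y).det ≠ 0) {ν : E2 → Mink}
    (hν : ContDiffOn ℝ ∞ ν U) (hn : ∀ z ∈ U, ∀ k, mink (ν z) (partialD k f z) = 0)
    (a b : E2) {y : E2} (hy : y ∈ U) {n : Mink} (hny : ∀ k, mink n (partialD k f y) = 0) :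
    mink (dirD a (fun z => inducedProj f z (dirD b ν z)) y) n =
      mink (dirD a (dirD b ν) y) n
        + (shapeCoeff f ν b 0 y * mink (dirD a (partialD 0 f) y) n
          + shapeCoeff f ν b 1 y * mink (dirD a (partialD 1 f) y) n) := by
  have hd {V : Type} [NormedAddCommGroup V] [NormedSpace ℝ V] {g : E2 → V}
      (hg : ContDiffOn ℝ ∞ g U) := differentiableAt_of_contDiffOn hU hg hy
  have hc := contDiffOn_shapeCoeff hU hf hD hν b
  have hp := contDiffOn_partialD hU hf
  have hs (k : Fin 2) : ContDiffOn ℝ ∞ (fun z => shapeCoeff f ν b k z • partialD k f z) U :=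
    (hc k).smul (hp k)
  rw [dirD_congr hU (fun z hz => inducedProj_dirD hU hf hν hn b hz) hy,
    dirD_add (hd (contDiffOn_dirD hU hν b)) (hd ((hs 0).add (hs 1))),
    dirD_add (hd (hs 0)) (hd (hs 1)),
    dirD_smul (hd (hc 0)) (hd (hp 0)), dirD_smul (hd (hc 1)) (hd (hp 1))]
  simp only [mink_add_left, mink_smul_left, mink_comm (partialD _ f y) n, hny]
  ring

/-- The Ricci equation. -/
theorem ricci_equation (hU : IsOpen U) (hf : ContDiffOn ℝ ∞ f U)
    (hD : ∀ y ∈ U, (inducedMetric f y).det ≠ 0) (a b : E2) {y : E2} (hy : y ∈ U) {ξ n : Mink}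
    (hξ : ∀ k, mink ξ (partialD k f y) = 0) (hn : ∀ k, mink n (partialD k f y) = 0) :
    mink (inducedProj f y (dirD a (fun z => inducedProj f z
        (dirD b (fun z => inducedProj f z ξ) z)) y)
      - inducedProj f y (dirD b (fun z => inducedProj f z
        (dirD a (fun z => inducedProj f z ξ) z)) y)) n =
      (a 0 * b 1 - a 1 * b 0) * ∑ k, ∑ l, (inducedMetric f y)⁻¹ k l *
        (mink ξ (partialD 1 (partialD l f) y) * mink (partialD 0 (partialD k f) y) n
          - mink ξ (partialD 0 (partialD l f) y) * mink (partialD 1 (partialD k f) y) n) := by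
  have hν := contDiffOn_inducedProj hU hf hD (contDiffOn_const (c := ξ))
  have hνn : ∀ z ∈ U, ∀ k, mink (inducedProj f z ξ) (partialD k f z) = 0 :=
    fun z hz k => mink_inducedProj_tangent (hD z hz) ξ k
  rw [mink_sub_left, mink_inducedProj_normal hn, mink_inducedProj_normal hn,
    mink_dirD_inducedProj_dirD hU hf hD hν hνn a b hy hn,
    -- The mixed second derivatives of the normal field cancel. What is left is alternating in `(a,
    -- b)`, hence the factor `a 0 * b 1 - a 1 * b 0`.
    mink_dirD_inducedProj_dirD hU hf hD hν hνn b a hy hn, dirD_comm hU hν hy b a]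
  simp only [shapeCoeff, inducedProj_of_normal hξ, dirD_eq_sum a, dirD_eq_sum b, mink_add_left,
    mink_add_right, mink_smul_left, mink_smul_right, Fin.sum_univ_two]
  ring

/-- The triple product of the bivector of a coordinate frame with its derivatives, in terms of the
curvatures. -/
theorem mixed_eq_curvature (hU : IsOpen U) (hf : ContDiffOn ℝ ∞ f U) {y : E2} (hy : y ∈ U)
    {v w n₀ n₁ : Mink} (hp : IsSpacelikePair v w) (hn : IsNormalFrame v w n₀ n₁) {p q r s : ℝ}
    (h0 : partialD 0 f y = p • v + q • w) (h1 : partialD 1 f y = r • v + s • w)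
    (hδ : p * s - q * r ≠ 0) {K KN : ℝ}
    (hK : K * (p * s - q * r) ^ 2 =
      mink (partialD 0 (partialD 0 f) y) (partialD 1 (partialD 1 f) y)
      - mink (partialD 0 (partialD 1 f) y) (partialD 0 (partialD 1 f) y)
      - ∑ l, mink (partialD 0 (partialD 0 f) y) (partialD l f y) * inducedChristoffel f l 1 1 y
      + ∑ l, mink (partialD 0 (partialD 1 f) y) (partialD l f y) *
          inducedChristoffel f l 0 1 y)
    (hKN : KN * (p * s - q * r) = ∑ k, ∑ l, (inducedMetric f y)⁻¹ k l *
        (mink n₀ (partialD 1 (partialD l f) y) * mink (partialD 0 (partialD k f) y) n₁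
          - mink n₀ (partialD 0 (partialD l f) y) * mink (partialD 1 (partialD k f) y) n₁)) :
    mixed (bivector (partialD 0 (partialD 0 f) y) (partialD 1 f y)
        + bivector (partialD 0 f y) (partialD 0 (partialD 1 f) y))
      (bivector (partialD 1 (partialD 0 f) y) (partialD 1 f y)
        + bivector (partialD 0 f y) (partialD 1 (partialD 1 f) y))
      (bivector (partialD 0 f y) (partialD 1 f y)) =
      ((p * s - q * r : ℝ) : ℂ) ^ 4 * ((K : ℂ) + Complex.I * (KN : ℂ)) := by
  have hdet : (inducedMetric f y).det = (p * s - q * r) ^ 2 := by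
    obtain ⟨k1, k2, k3⟩ := hp
    rw [inducedMetric_det, h0, h1]
    simp only [mink_add_left, mink_add_right, mink_smul_left, mink_smul_right, k1, k2, k3,
      mink_comm w v]
    ring
  have hinv : (inducedMetric f y)⁻¹ = ((p * s - q * r) ^ 2)⁻¹ •
      !![mink (partialD 1 f y) (partialD 1 f y), -mink (partialD 0 f y) (partialD 1 f y);
        -mink (partialD 0 f y) (partialD 1 f y), mink (partialD 0 f y) (partialD 0 f y)] := by
    rw [Matrix.inv_def, Matrix.adjugate_fin_two, hdet, Ring.inverse_eq_inv']
    simp only [inducedMetric_apply, mink_comm (partialD 1 f y) (partialD 0 f y)]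
  have hs : partialD 1 (partialD 0 f) y = partialD 0 (partialD 1 f) y :=
    partialD_comm hU hf hy 1 0
  have hvol (x z : Mink) : vol x z (partialD 0 f y) (partialD 1 f y) =
      (p * s - q * r) * (mink x n₁ * mink z n₀ - mink x n₀ * mink z n₁) := by
    rw [h0, h1]
    exact vol_normalFrame hp hn x z p q r s
  rw [inducedMetric_det] at hdet
  simp only [inducedChristoffel, hinv, Fin.sum_univ_two, Matrix.smul_apply, smul_eq_mul, hs,
    Matrix.of_apply, Matrix.cons_val', Matrix.cons_val_zero, Matrix.cons_val_one,
    Matrix.cons_val_fin_one, mink_comm n₀] at hK hKN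
  rw [hs, mixed_derivatives, hvol, hvol, hvol, hdet]
  generalize p * s - q * r = δ at *
  field_simp at hK hKN
  -- In the real part, `δ²` comes from `det g` and `δ²` from `hK`. In the imaginary part, one `δ`
  -- comes from the volumes and `δ³` from `hKN` once the factor `δ⁻²` of the inverse metric is
  -- cleared.
  have e1 : ∀ R J : ℝ, R = δ ^ 4 * K → J = δ ^ 4 * KN →
      (R : ℂ) + Complex.I * (J : ℂ) = (δ : ℂ) ^ 4 * ((K : ℂ) + Complex.I * (KN : ℂ)) := by
    rintro R J rfl rfl
    push_cast
    ring
  refine e1 _ _ ?_ ?_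
  · linear_combination -hK
  · linear_combination (-δ) * hKN


end MinkowskiSurface

namespace MinkowskiSurface

/-! ### Coordinate expressions on the surface -/

variable {M : Type*} [TopologicalSpace M] [ChartedSpace E2 M]

theorem dMink_add (F : M → Mink) (x : M) (u v : TangentSpace 𝓘(ℝ, E2) x) :
    dMink F x (u + v) = dMink F x u + dMink F x v :=
  map_add (mfderiv 𝓘(ℝ, E2) 𝓘(ℝ, Mink) F x) u v

theorem dMink_smul (F : M → Mink) (x : M) (c : ℝ) (u : TangentSpace 𝓘(ℝ, E2) x) :
    dMink F x (c • u) = c • dMink F x u :=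
  map_smul (mfderiv 𝓘(ℝ, E2) 𝓘(ℝ, Mink) F x) c u

theorem dMink_sum (F : M → Mink) (x : M) {ι : Type*} (s : Finset ι)
    (u : ι → TangentSpace 𝓘(ℝ, E2) x) : dMink F x (∑ i ∈ s, u i) = ∑ i ∈ s, dMink F x (u i) :=
  map_sum (mfderiv 𝓘(ℝ, E2) 𝓘(ℝ, Mink) F x) u s

theorem eventuallyEq_comp_extChartAt {V : Type*} (g : M → V) (x : M) :
    g =ᶠ[nhds x] (g ∘ (extChartAt 𝓘(ℝ, E2) x).symm) ∘ extChartAt 𝓘(ℝ, E2) x := by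
  filter_upwards [extChartAt_source_mem_nhds (I := 𝓘(ℝ, E2)) x] with z hz
  simp only [Function.comp_apply, (extChartAt 𝓘(ℝ, E2) x).left_inv hz]

section Chart

variable [IsManifold 𝓘(ℝ, E2) ∞ M]

/-- The coordinate expression of a smooth map. -/
theorem contDiffOn_comp_extChartAt_symm {F : M → Mink} (hF : ContMDiff 𝓘(ℝ, E2) 𝓘(ℝ, Mink) ∞ F)
    (x : M) : ContDiffOn ℝ ∞ (F ∘ (extChartAt 𝓘(ℝ, E2) x).symm) (extChartAt 𝓘(ℝ, E2) x).target :=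
  contMDiffOn_iff_contDiffOn.1 (hF.comp_contMDiffOn (contMDiffOn_extChartAt_symm x))

theorem mdifferentiableAt_extChartAt_symm {x : M} {y : E2}
    (hy : y ∈ (extChartAt 𝓘(ℝ, E2) x).target) :
    MDifferentiableAt 𝓘(ℝ, E2) 𝓘(ℝ, E2) (extChartAt 𝓘(ℝ, E2) x).symm y :=
  ((contMDiffOn_extChartAt_symm (n := ∞) x).contMDiffAt
    ((isOpen_extChartAt_target x).mem_nhds hy)).mdifferentiableAt (by simp)

theorem dMink_mfderiv_symm {F : M → Mink} (hF : ContMDiff 𝓘(ℝ, E2) 𝓘(ℝ, Mink) ∞ F)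
    {x : M} {y : E2} (hy : y ∈ (extChartAt 𝓘(ℝ, E2) x).target) (a : E2) :
    dMink F ((extChartAt 𝓘(ℝ, E2) x).symm y)
      (mfderiv 𝓘(ℝ, E2) 𝓘(ℝ, E2) (extChartAt 𝓘(ℝ, E2) x).symm y a) =
      dirD a (F ∘ (extChartAt 𝓘(ℝ, E2) x).symm) y := by
  unfold dMink dirD
  rw [← mfderiv_eq_fderiv, mfderiv_comp y
    ((hF _).mdifferentiableAt (by simp)) (mdifferentiableAt_extChartAt_symm hy)]
  rfl

theorem dMink_coordVec {F : M → Mink} (hF : ContMDiff 𝓘(ℝ, E2) 𝓘(ℝ, Mink) ∞ F)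
    {x : M} {y : E2} (hy : y ∈ (extChartAt 𝓘(ℝ, E2) x).target) (i : Fin 2) :
    dMink F ((extChartAt 𝓘(ℝ, E2) x).symm y) (coordVec x y i) =
      partialD i (F ∘ (extChartAt 𝓘(ℝ, E2) x).symm) y :=
  dMink_mfderiv_symm hF hy _

theorem eq_sum_coordVec {x : M} {y : E2} (hy : y ∈ (extChartAt 𝓘(ℝ, E2) x).target)
    (u : TangentSpace 𝓘(ℝ, E2) ((extChartAt 𝓘(ℝ, E2) x).symm y)) (a : E2)
    (ha : a = mfderiv 𝓘(ℝ, E2) 𝓘(ℝ, E2) (extChartAt 𝓘(ℝ, E2) x)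
      ((extChartAt 𝓘(ℝ, E2) x).symm y) u) :
    u = a 0 • coordVec x y 0 + a 1 • coordVec x y 1 := by
  have h1 := mfderivWithin_extChartAt_symm_comp_mfderiv_extChartAt (I := 𝓘(ℝ, E2)) hy
  have h := DFunLike.congr_fun h1 u
  have hr : Set.range (𝓘(ℝ, E2) : E2 → E2) = Set.univ := by simp
  rw [hr, mfderivWithin_univ] at h
  have h2 : mfderiv 𝓘(ℝ, E2) 𝓘(ℝ, E2) (extChartAt 𝓘(ℝ, E2) x).symm y a = u := by
    rw [ha]; exact h
  have h3 : a = a 0 • EuclideanSpace.single (0 : Fin 2) (1 : ℝ) +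
      a 1 • EuclideanSpace.single (1 : Fin 2) (1 : ℝ) := by
    ext i
    fin_cases i <;> simp
  rw [← h2]
  conv_lhs => rw [h3]
  unfold coordVec
  exact (map_add _ _ _).trans (congrArg₂ _ (map_smul _ _ _) (map_smul _ _ _))

/-- Derivatives on the surface reduce to derivatives in the chart: `g` agrees near `x` with its
coordinate expression composed with the chart. -/
theorem mfderiv_eq_dirD {V : Type*} [NormedAddCommGroup V] [NormedSpace ℝ V] (g : M → V) (x : M)
    (hg : DifferentiableAt ℝ (g ∘ (extChartAt 𝓘(ℝ, E2) x).symm) (extChartAt 𝓘(ℝ, E2) x x))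
    (u : TangentSpace 𝓘(ℝ, E2) x) (a : E2)
    (ha : a = mfderiv 𝓘(ℝ, E2) 𝓘(ℝ, E2) (extChartAt 𝓘(ℝ, E2) x) x u) :
    mfderiv 𝓘(ℝ, E2) 𝓘(ℝ, V) g x u =
      dirD a (g ∘ (extChartAt 𝓘(ℝ, E2) x).symm) (extChartAt 𝓘(ℝ, E2) x x) := by
  have h := congrArg (fun L : E2 →L[ℝ] V => L u)
    ((eventuallyEq_comp_extChartAt g x).mfderiv_eq (I := 𝓘(ℝ, E2)) (I' := 𝓘(ℝ, V)))
  refine h.trans ?_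
  rw [mfderiv_comp x hg.mdifferentiableAt
    (mdifferentiableAt_extChartAt (mem_chart_source E2 x)), mfderiv_eq_fderiv, ha]
  rfl

end Chart

/-! ### Area form, oriented frames and the Gauss map -/

variable [RiemannianBundle (fun x : M => TangentSpace 𝓘(ℝ, E2) x)]

theorem areaForm_eq (o : ∀ x : M, Orientation ℝ (TangentSpace 𝓘(ℝ, E2) x) (Fin 2)) (x : M)
    (u v : TangentSpace 𝓘(ℝ, E2) x) : (o x).areaForm u v =
      inner ℝ (tangentFrame o x 0) u * inner ℝ (tangentFrame o x 1) v
        - inner ℝ (tangentFrame o x 1) u * inner ℝ (tangentFrame o x 0) v := by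
  rw [Orientation.areaForm_to_volumeForm, (o x).volumeForm_robust (tangentFrame o x)
    ((o x).finOrthonormalBasis_orientation _ _), Basis.det_apply, Matrix.det_fin_two]
  simp [Basis.toMatrix_apply, OrthonormalBasis.repr_apply_apply]
  ring

theorem eq_sum_tangentFrame (o : ∀ x : M, Orientation ℝ (TangentSpace 𝓘(ℝ, E2) x) (Fin 2)) (x : M)
    (u : TangentSpace 𝓘(ℝ, E2) x) :
    u = (inner ℝ (tangentFrame o x 0) u : ℝ) • tangentFrame o x 0
      + (inner ℝ (tangentFrame o x 1) u : ℝ) • tangentFrame o x 1 := by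
  have h := (tangentFrame o x).sum_repr' u
  rw [Fin.sum_univ_two] at h
  exact h.symm

theorem areaForm_tangentFrame (o : ∀ x : M, Orientation ℝ (TangentSpace 𝓘(ℝ, E2) x) (Fin 2))
    (x : M) : (o x).areaForm (tangentFrame o x 0) (tangentFrame o x 1) = 1 := by
  rw [areaForm_eq]
  simp

variable {F : M → Mink} (hF : IsIsometricImmersion F)
  (o : ∀ x : M, Orientation ℝ (TangentSpace 𝓘(ℝ, E2) x) (Fin 2))

theorem dMink_eq (x : M) (u : TangentSpace 𝓘(ℝ, E2) x) :
    dMink F x u = (inner ℝ (tangentFrame o x 0) u : ℝ) • dMink F x (tangentFrame o x 0)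
      + (inner ℝ (tangentFrame o x 1) u : ℝ) • dMink F x (tangentFrame o x 1) := by
  conv_lhs => rw [eq_sum_tangentFrame o x u]
  rw [dMink_add, dMink_smul, dMink_smul]

theorem gaussMap_eq (x : M) : gaussMap hF o x =
    bivector (dMink F x (tangentFrame o x 0)) (dMink F x (tangentFrame o x 1)) := rfl

theorem gaussMap_mem_quadric (x : M) : gaussMap hF o x ∈ quadric :=
  (planeToQuadric (gaussPlane hF o x)).2

theorem bivector_self (v : Mink) : bivector v v = 0 := by
  ext <;> simp [bivector_re, bivector_imI, bivector_imJ, bivector_imK] <;> ring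

theorem bivector_swap (v w : Mink) : bivector v w = (-1 : ℂ) • bivector w v := by
  ext <;> simp [bivector_re, bivector_imI, bivector_imJ, bivector_imK] <;> ring

/-- The wedge is alternating bilinear, so on the tangent plane it is the area form times its value
on an oriented orthonormal basis. This frees the Gauss map from `tangentFrame`, which is chosen
pointwise without any smoothness. -/
theorem bivector_dMink (x : M) (u v : TangentSpace 𝓘(ℝ, E2) x) :
    bivector (dMink F x u) (dMink F x v) = ((o x).areaForm u v : ℂ) • gaussMap hF o x := by
  rw [dMink_eq o x u, dMink_eq o x v, areaForm_eq, gaussMap_eq]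
  simp only [bivector_add_left, bivector_add_right, bivector_smul_left, bivector_smul_right,
    bivector_self, bivector_swap (dMink F x (tangentFrame o x 1)) (dMink F x (tangentFrame o x 0))]
  push_cast
  module

variable [IsManifold 𝓘(ℝ, E2) ∞ M]

/-- The area of the coordinate frame. -/
noncomputable def coordArea (x : M) (y : E2) : ℝ :=
  (o ((extChartAt 𝓘(ℝ, E2) x).symm y)).areaForm (coordVec x y 0) (coordVec x y 1)

theorem areaForm_eq_coordArea {x : M} {y : E2} (hy : y ∈ (extChartAt 𝓘(ℝ, E2) x).target)
    (u v : TangentSpace 𝓘(ℝ, E2) ((extChartAt 𝓘(ℝ, E2) x).symm y)) (a b : E2)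
    (ha : a = mfderiv 𝓘(ℝ, E2) 𝓘(ℝ, E2) (extChartAt 𝓘(ℝ, E2) x)
      ((extChartAt 𝓘(ℝ, E2) x).symm y) u)
    (hb : b = mfderiv 𝓘(ℝ, E2) 𝓘(ℝ, E2) (extChartAt 𝓘(ℝ, E2) x)
      ((extChartAt 𝓘(ℝ, E2) x).symm y) v) :
    (o ((extChartAt 𝓘(ℝ, E2) x).symm y)).areaForm u v =
      (a 0 * b 1 - a 1 * b 0) * coordArea o x y := by
  rw [eq_sum_coordVec hy u a ha, eq_sum_coordVec hy v b hb]
  simp only [map_add, map_smul, LinearMap.add_apply, LinearMap.smul_apply, smul_eq_mul,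
    Orientation.areaForm_apply_self, coordArea,
    (o ((extChartAt 𝓘(ℝ, E2) x).symm y)).areaForm_swap (coordVec x y 1) (coordVec x y 0)]
  ring

theorem coordArea_ne_zero {x : M} {y : E2} (hy : y ∈ (extChartAt 𝓘(ℝ, E2) x).target) :
    coordArea o x y ≠ 0 := by
  intro h
  have h1 := areaForm_tangentFrame o ((extChartAt 𝓘(ℝ, E2) x).symm y)
  rw [areaForm_eq_coordArea o hy _ _ _ _ rfl rfl, h, mul_zero] at h1
  exact zero_ne_one h1

theorem bivector_partialD {x : M} {y : E2} (hy : y ∈ (extChartAt 𝓘(ℝ, E2) x).target) :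
    bivector (partialD 0 (F ∘ (extChartAt 𝓘(ℝ, E2) x).symm) y)
      (partialD 1 (F ∘ (extChartAt 𝓘(ℝ, E2) x).symm) y) =
      (coordArea o x y : ℂ) • gaussMap hF o ((extChartAt 𝓘(ℝ, E2) x).symm y) := by
  rw [← dMink_coordVec hF.smooth hy, ← dMink_coordVec hF.smooth hy, bivector_dMink hF o]
  rfl

/-! ### Metric, Christoffel symbols and Gauss curvature in a chart -/

theorem metricMatrix_eq (hF : IsIsometricImmersion F) {x : M} {y : E2}
    (hy : y ∈ (extChartAt 𝓘(ℝ, E2) x).target) :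
    metricMatrix x y = inducedMetric (F ∘ (extChartAt 𝓘(ℝ, E2) x).symm) y := by
  ext i j
  rw [inducedMetric_apply, ← dMink_coordVec hF.smooth hy, ← dMink_coordVec hF.smooth hy,
    hF.isometric]
  rfl

theorem inducedMetric_det_eq (hF : IsIsometricImmersion F) {x : M} {y : E2}
    (hy : y ∈ (extChartAt 𝓘(ℝ, E2) x).target) :
    (inducedMetric (F ∘ (extChartAt 𝓘(ℝ, E2) x).symm) y).det = coordArea o x y ^ 2 := by
  have h := tangentFrame_pair hF o ((extChartAt 𝓘(ℝ, E2) x).symm y)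
  rw [inducedMetric_det, ← dMink_coordVec hF.smooth hy, ← dMink_coordVec hF.smooth hy,
    dMink_eq o _ (coordVec x y 0), dMink_eq o _ (coordVec x y 1), coordArea, areaForm_eq]
  obtain ⟨k1, k2, k3⟩ := h
  simp only [mink_add_left, mink_add_right, mink_smul_left, mink_smul_right, k1, k2, k3,
      mink_comm (dMink F _ (tangentFrame o _ 1)) (dMink F _ (tangentFrame o _ 0))]
  ring

theorem inducedMetric_det_ne_zero
    (o : ∀ x : M, Orientation ℝ (TangentSpace 𝓘(ℝ, E2) x) (Fin 2)) (hF : IsIsometricImmersion F) {x : M} {y : E2}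
    (hy : y ∈ (extChartAt 𝓘(ℝ, E2) x).target) :
    (inducedMetric (F ∘ (extChartAt 𝓘(ℝ, E2) x).symm) y).det ≠ 0 := by
  rw [inducedMetric_det_eq o hF hy]
  exact pow_ne_zero 2 (coordArea_ne_zero o hy)

/-- With `g_ij = ⟨∂_i f, ∂_j f⟩` and symmetric second derivatives, the three metric derivatives
combine to `2 ⟨∂_i ∂_j f, ∂_l f⟩`. -/
theorem christoffel_eq (hF : IsIsometricImmersion F) {x : M} {y : E2}
    (hy : y ∈ (extChartAt 𝓘(ℝ, E2) x).target) (k i j : Fin 2) :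
    christoffel x k i j y = inducedChristoffel (F ∘ (extChartAt 𝓘(ℝ, E2) x).symm) k i j y := by
  have hU := isOpen_extChartAt_target (I := 𝓘(ℝ, E2)) x
  have hf := contDiffOn_comp_extChartAt_symm hF.smooth x
  have hp := contDiffOn_partialD hU hf
  have hd (i : Fin 2) := differentiableAt_of_contDiffOn hU (hp i) hy
  have h (m i j : Fin 2) : pd m (fun z => metricMatrix x z i j) y =
      mink (partialD m (partialD i (F ∘ (extChartAt 𝓘(ℝ, E2) x).symm)) y)
          (partialD j (F ∘ (extChartAt 𝓘(ℝ, E2) x).symm) y)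
        + mink (partialD i (F ∘ (extChartAt 𝓘(ℝ, E2) x).symm) y)
          (partialD m (partialD j (F ∘ (extChartAt 𝓘(ℝ, E2) x).symm)) y) := by
    rw [pd_eq_partialD, partialD_congr hU (fun z hz => congrFun₂ (metricMatrix_eq hF hz) i j) hy]
    exact partialD_mink (hd i) (hd j) m
  unfold christoffel inducedChristoffel
  rw [metricMatrix_eq hF hy, Finset.mul_sum]
  refine Finset.sum_congr rfl fun l _ => ?_
  rw [h, h, h, partialD_comm hU hf hy j i, partialD_comm hU hf hy l i,
    partialD_comm hU hf hy l j,
    mink_comm (partialD j (F ∘ (extChartAt 𝓘(ℝ, E2) x).symm) y),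
    mink_comm (partialD i (F ∘ (extChartAt 𝓘(ℝ, E2) x).symm) y)
      (partialD j (partialD l (F ∘ (extChartAt 𝓘(ℝ, E2) x).symm)) y)]
  ring

/-- The Gauss equation on the surface. -/
theorem gaussCurvature_mul (hF : IsIsometricImmersion F) (x : M) (f : E2 → Mink)
    (hf : f = F ∘ (extChartAt 𝓘(ℝ, E2) x).symm) (y : E2) (hy : y = extChartAt 𝓘(ℝ, E2) x x) :
    gaussCurvature x * coordArea o x y ^ 2 =
      mink (partialD 0 (partialD 0 f) y) (partialD 1 (partialD 1 f) y)
      - mink (partialD 0 (partialD 1 f) y) (partialD 0 (partialD 1 f) y)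
      - ∑ l, mink (partialD 0 (partialD 0 f) y) (partialD l f y) * inducedChristoffel f l 1 1 y
      + ∑ l, mink (partialD 0 (partialD 1 f) y) (partialD l f y) *
          inducedChristoffel f l 0 1 y := by
  have hU := isOpen_extChartAt_target (I := 𝓘(ℝ, E2)) x
  have hm : y ∈ (extChartAt 𝓘(ℝ, E2) x).target := hy ▸ mem_extChartAt_target x
  rw [← gauss_equation hU (hf ▸ contDiffOn_comp_extChartAt_symm hF.smooth x)
    (fun z hz => hf ▸ inducedMetric_det_ne_zero o hF hz) hm, gaussCurvature, ← hy,
    metricMatrix_eq hF hm, inducedMetric_det_eq o hF hm,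
    div_mul_cancel₀ _ (pow_ne_zero 2 (coordArea_ne_zero o hm)), ← hf]
  refine Finset.sum_congr rfl fun l _ => ?_
  have hc (m k i j : Fin 2) : pd m (christoffel x k i j) y =
      partialD m (inducedChristoffel f k i j) y := by
    rw [pd_eq_partialD, hf]
    exact partialD_congr hU (fun z hz => christoffel_eq hF hz k i j) hm m
  simp only [riemannCoeff, hc, christoffel_eq hF hm, ← hf]


end MinkowskiSurface

namespace MinkowskiSurface

variable {M : Type*} [TopologicalSpace M] [ChartedSpace E2 M]
  [RiemannianBundle (fun x : M => TangentSpace 𝓘(ℝ, E2) x)]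
  {F : M → Mink} (hF : IsIsometricImmersion F)
  (o : ∀ x : M, Orientation ℝ (TangentSpace 𝓘(ℝ, E2) x) (Fin 2))
  [IsManifold 𝓘(ℝ, E2) ∞ M]

/-! ### The Ricci equation on the surface -/

/-- Both sides remove the tangent part of `v`, one through an orthonormal basis and the other
through the coordinate frame. The removed vector is `dF(t)`, where `t` represents `w ↦ ⟨v, dF(w)⟩`
for the Riemannian metric. -/
theorem normalProj_eq (hF : IsIsometricImmersion F) {x : M} {y : E2}
    (hy : y ∈ (extChartAt 𝓘(ℝ, E2) x).target)
    (hD : (inducedMetric (F ∘ (extChartAt 𝓘(ℝ, E2) x).symm) y).det ≠ 0) (v : Mink) :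
    normalProj F ((extChartAt 𝓘(ℝ, E2) x).symm y) v =
      inducedProj (F ∘ (extChartAt 𝓘(ℝ, E2) x).symm) y v := by
  set f := F ∘ (extChartAt 𝓘(ℝ, E2) x).symm with hf
  set z := (extChartAt 𝓘(ℝ, E2) x).symm y with hz
  set c : Fin 2 → ℝ := fun k => ∑ l, (inducedMetric f y)⁻¹ k l * mink v (partialD l f y)
  let t : TangentSpace 𝓘(ℝ, E2) z := ∑ k, c k • coordVec x y k
  have ht : dMink F z t = ∑ k, c k • partialD k f y := by
    rw [dMink_sum]
    refine Finset.sum_congr rfl fun k _ => ?_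
    rw [dMink_smul, dMink_coordVec hF.smooth hy]
  have hp : inducedProj f y v = v - dMink F z t := by rw [ht]; rfl
  have hw (w : TangentSpace 𝓘(ℝ, E2) z) : mink v (dMink F z w) = inner ℝ t w := by
    have h0 : mink (inducedProj f y v) (dMink F z w) = 0 := by
      rw [eq_sum_coordVec hy w _ rfl, dMink_add, dMink_smul, dMink_smul,
        dMink_coordVec hF.smooth hy, dMink_coordVec hF.smooth hy, mink_add_right,
        mink_smul_right, mink_smul_right, mink_inducedProj_tangent hD,
        mink_inducedProj_tangent hD]
      ring
    rw [hp, mink_sub_left, hF.isometric] at h0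
    linarith
  rw [hp, normalProj]
  congr 1
  conv_rhs => rw [← (stdOrthonormalBasis ℝ (TangentSpace 𝓘(ℝ, E2) z)).sum_repr' t, dMink_sum]
  refine Finset.sum_congr rfl fun i _ => ?_
  rw [dMink_smul, hw, real_inner_comm]

theorem exists_frame_coeff (x : M) {z : M} {y : E2} (hF : IsIsometricImmersion F)
    (hy : y ∈ (extChartAt 𝓘(ℝ, E2) x).target) (hz : (extChartAt 𝓘(ℝ, E2) x).symm y = z) :
    ∃ p q r s : ℝ,
      partialD 0 (F ∘ (extChartAt 𝓘(ℝ, E2) x).symm) y =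
        p • dMink F z (tangentFrame o z 0) + q • dMink F z (tangentFrame o z 1) ∧
      partialD 1 (F ∘ (extChartAt 𝓘(ℝ, E2) x).symm) y =
        r • dMink F z (tangentFrame o z 0) + s • dMink F z (tangentFrame o z 1) ∧
      coordArea o x y = p * s - q * r := by
  subst hz
  refine ⟨_, _, _, _, ?_, ?_, areaForm_eq o _ _ _⟩
  · rw [← dMink_coordVec hF.smooth hy]
    exact dMink_eq o _ _
  · rw [← dMink_coordVec hF.smooth hy]
    exact dMink_eq o _ _

/-- The base point is a variable `z` so that the formula applies to tangent vectors at `x` itself,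
which is only propositionally equal to the image of its coordinates. -/
theorem areaForm_eq_coordArea_of_eq {x z : M} {y : E2}
    (hy : y ∈ (extChartAt 𝓘(ℝ, E2) x).target) (hz : (extChartAt 𝓘(ℝ, E2) x).symm y = z)
    (u v : TangentSpace 𝓘(ℝ, E2) z) (a b : E2)
    (ha : a = mfderiv 𝓘(ℝ, E2) 𝓘(ℝ, E2) (extChartAt 𝓘(ℝ, E2) x) z u)
    (hb : b = mfderiv 𝓘(ℝ, E2) 𝓘(ℝ, E2) (extChartAt 𝓘(ℝ, E2) x) z v) :
    (o z).areaForm u v = (a 0 * b 1 - a 1 * b 0) * coordArea o x y := by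
  subst hz
  exact areaForm_eq_coordArea o hy u v a b ha hb

theorem normalDeriv_eq (hF : IsIsometricImmersion F) {x : M} {y : E2}
    (hy : y ∈ (extChartAt 𝓘(ℝ, E2) x).target)
    (hD : (inducedMetric (F ∘ (extChartAt 𝓘(ℝ, E2) x).symm) y).det ≠ 0) (a : E2)
    {ν ν' : E2 → Mink} (hν : ∀ z ∈ (extChartAt 𝓘(ℝ, E2) x).target, ν z = ν' z) :
    normalDeriv F x a ν y =
      inducedProj (F ∘ (extChartAt 𝓘(ℝ, E2) x).symm) y (dirD a ν' y) := by
  rw [normalDeriv, normalProj_eq hF hy hD]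
  exact congrArg _ (dirD_congr (isOpen_extChartAt_target x) hν hy a)

/-- The Ricci equation on the surface. -/
theorem normalCurvature_mul (x : M) (f : E2 → Mink)
    (hf : f = F ∘ (extChartAt 𝓘(ℝ, E2) x).symm) (y : E2) (hy : y = extChartAt 𝓘(ℝ, E2) x x)
    (n₀ n₁ : Mink) (hn : (n₀, n₁) = normalFrame hF o x)
    (hn₀ : ∀ k, mink n₀ (partialD k f y) = 0) (hn₁ : ∀ k, mink n₁ (partialD k f y) = 0) :
    normalCurvature hF o x * coordArea o x y = ∑ k, ∑ l, (inducedMetric f y)⁻¹ k l *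
        (mink n₀ (partialD 1 (partialD l f) y) * mink (partialD 0 (partialD k f) y) n₁
          - mink n₀ (partialD 0 (partialD l f) y) * mink (partialD 1 (partialD k f) y) n₁) := by
  have hU := isOpen_extChartAt_target (I := 𝓘(ℝ, E2)) x
  have hm : y ∈ (extChartAt 𝓘(ℝ, E2) x).target := hy ▸ mem_extChartAt_target x
  have hx : (extChartAt 𝓘(ℝ, E2) x).symm y = x := hy ▸ extChartAt_to_inv x
  have hD : ∀ z ∈ (extChartAt 𝓘(ℝ, E2) x).target, (inducedMetric f z).det ≠ 0 :=
    fun z hz => hf ▸ inducedMetric_det_ne_zero o hF hz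
  let a : E2 := mfderiv 𝓘(ℝ, E2) 𝓘(ℝ, E2) (extChartAt 𝓘(ℝ, E2) x) x (tangentFrame o x 0)
  let b : E2 := mfderiv 𝓘(ℝ, E2) 𝓘(ℝ, E2) (extChartAt 𝓘(ℝ, E2) x) x (tangentFrame o x 1)
  have hab := areaForm_eq_coordArea_of_eq o hm hx _ _ a b rfl rfl
  rw [areaForm_tangentFrame] at hab
  have hR := ricci_equation hU (hf ▸ contDiffOn_comp_extChartAt_symm hF.smooth x) hD a b hm
    hn₀ hn₁
  have hν : ∀ z ∈ (extChartAt 𝓘(ℝ, E2) x).target,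
      normalProj F ((extChartAt 𝓘(ℝ, E2) x).symm z) n₀ = inducedProj f z n₀ :=
    fun z hz => hf ▸ normalProj_eq hF hz (hf ▸ hD z hz) n₀
  -- Equality on the whole chart domain is required, since this field is differentiated again.
  have hN (c : E2) : ∀ z ∈ (extChartAt 𝓘(ℝ, E2) x).target,
      normalDeriv F x c (fun y => normalProj F ((extChartAt 𝓘(ℝ, E2) x).symm y) n₀) z =
        inducedProj f z (dirD c (fun z => inducedProj f z n₀) z) :=
    fun z hz => hf ▸ normalDeriv_eq hF hz (hf ▸ hD z hz) c (hf ▸ hν)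
  have hNN (c d : E2) : normalDeriv F x c (normalDeriv F x d
      (fun y => normalProj F ((extChartAt 𝓘(ℝ, E2) x).symm y) n₀)) y =
        inducedProj f y (dirD c (fun z => inducedProj f z
          (dirD d (fun z => inducedProj f z n₀) z)) y) :=
    hf ▸ normalDeriv_eq hF hm (hf ▸ hD y hm) c (hf ▸ hN d)
  have hK : normalCurvature hF o x = mink (normalDeriv F x a (normalDeriv F x b
      (fun y => normalProj F ((extChartAt 𝓘(ℝ, E2) x).symm y) n₀)) y -
      normalDeriv F x b (normalDeriv F x a
      (fun y => normalProj F ((extChartAt 𝓘(ℝ, E2) x).symm y) n₀)) y) n₁ := by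
    rw [hy, normalCurvature, ← hn]
    rfl
  -- The oriented orthonormal frame has area `1`, so `(a 0 * b 1 - a 1 * b 0) δ = 1`.
  rw [hK, hNN, hNN, hR, mul_right_comm, ← hab, one_mul]

/-! ### The differential of the Gauss map -/

theorem imCoord_add (p q : ℍ[ℂ]) : imCoord (p + q) = imCoord p + imCoord q := by
  ext i
  fin_cases i <;> simp [imCoord]

theorem imCoord_smul (c : ℂ) (q : ℍ[ℂ]) : imCoord (c • q) = c • imCoord q := by
  ext i
  fin_cases i <;> simp [imCoord]

theorem ofImCoord_imCoord {q : ℍ[ℂ]} (hq : q.re = 0) : ofImCoord (imCoord q) = q := by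
  ext <;> simp [imCoord, ofImCoord, hq]

theorem ofImCoord_add (z w : Fin 3 → ℂ) : ofImCoord (z + w) = ofImCoord z + ofImCoord w := by
  ext
  · exact (add_zero (0 : ℂ)).symm
  all_goals rfl

theorem ofImCoord_smul (c : ℂ) (z : Fin 3 → ℂ) : ofImCoord (c • z) = c • ofImCoord z := by
  ext
  · exact (mul_zero c).symm
  all_goals rfl

theorem real_smul_eq (c : ℝ) (z : Fin 3 → ℂ) : c • z = (c : ℂ) • z := by
  ext i
  simp

/-- The coordinates of the bivector of two vectors, as a continuous bilinear map. -/
noncomputable def bivectorCLM : Mink →L[ℝ] Mink →L[ℝ] (Fin 3 → ℂ) :=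
  (LinearMap.mk₂ ℝ (fun v w => imCoord (bivector v w))
    (fun u v w => by rw [bivector_add_left, imCoord_add])
    (fun c v w => by rw [bivector_smul_left, imCoord_smul, real_smul_eq])
    (fun u v w => by rw [bivector_add_right, imCoord_add])
    (fun c v w => by
      rw [bivector_smul_right, imCoord_smul, real_smul_eq])).toContinuousBilinearMap

theorem bivectorCLM_apply (v w : Mink) : bivectorCLM v w = imCoord (bivector v w) := rfl

/-- The inverse of the area of the coordinate frame is smooth. -/
theorem contDiffOn_inv_coordArea (hF : IsIsometricImmersion F) (ho : IsSurfaceOrientation o)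
    (x : M) : ∃ W : Set E2, IsOpen W ∧ extChartAt 𝓘(ℝ, E2) x x ∈ W ∧
      W ⊆ (extChartAt 𝓘(ℝ, E2) x).target ∧
      ContDiffOn ℝ ∞ (fun y => (coordArea o x y)⁻¹) W := by
  have hU := isOpen_extChartAt_target (I := 𝓘(ℝ, E2)) x
  have hx := mem_extChartAt_target (I := 𝓘(ℝ, E2)) x
  have hs : ContDiffOn ℝ ∞
      (fun y => (√(inducedMetric (F ∘ (extChartAt 𝓘(ℝ, E2) x).symm) y).det)⁻¹)
      (extChartAt 𝓘(ℝ, E2) x).target := by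
    have hf := contDiffOn_comp_extChartAt_symm hF.smooth x
    refine ContDiffOn.inv ((contDiffOn_inducedMetric_det hU hf).sqrt
      fun y hy => inducedMetric_det_ne_zero o hF hy) fun y hy => ?_
    rw [inducedMetric_det_eq o hF hy, Real.sqrt_sq_eq_abs]
    exact abs_ne_zero.2 (coordArea_ne_zero o hy)
  -- The relation `det g = δ²` fixes `δ` only up to sign. The orientation makes the sign constant
  -- near the point, so `δ⁻¹` is there `(√det g)⁻¹` or its opposite.
  rcases ho x with h | h
  · obtain ⟨W, hW, hWo, hxW⟩ := eventually_nhds_iff.1 h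
    refine ⟨W ∩ (extChartAt 𝓘(ℝ, E2) x).target, hWo.inter hU, ⟨hxW, hx⟩, Set.inter_subset_right,
      (hs.mono Set.inter_subset_right).congr fun y hy => ?_⟩
    have : 0 < coordArea o x y := hW y hy.1
    rw [inducedMetric_det_eq o hF hy.2, Real.sqrt_sq this.le]
  · obtain ⟨W, hW, hWo, hxW⟩ := eventually_nhds_iff.1 h
    refine ⟨W ∩ (extChartAt 𝓘(ℝ, E2) x).target, hWo.inter hU, ⟨hxW, hx⟩, Set.inter_subset_right,
      (hs.neg.mono Set.inter_subset_right).congr fun y hy => ?_⟩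
    have : coordArea o x y < 0 := hW y hy.1
    rw [inducedMetric_det_eq o hF hy.2, Real.sqrt_sq_eq_abs, abs_of_neg this, inv_neg, neg_neg]

theorem imCoord_gaussMap_symm {x : M} {y : E2} (hy : y ∈ (extChartAt 𝓘(ℝ, E2) x).target) :
    imCoord (gaussMap hF o ((extChartAt 𝓘(ℝ, E2) x).symm y)) =
      (coordArea o x y)⁻¹ • bivectorCLM (partialD 0 (F ∘ (extChartAt 𝓘(ℝ, E2) x).symm) y)
        (partialD 1 (F ∘ (extChartAt 𝓘(ℝ, E2) x).symm) y) := by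
  have h : (coordArea o x y : ℂ) ≠ 0 := Complex.ofReal_ne_zero.2 (coordArea_ne_zero o hy)
  rw [bivectorCLM_apply, bivector_partialD hF o hy, real_smul_eq, imCoord_smul, smul_smul,
    Complex.ofReal_inv, inv_mul_cancel₀ h, one_smul]

theorem contDiffAt_imCoord_gaussMap_symm (ho : IsSurfaceOrientation o) (x : M) :
    ContDiffAt ℝ ∞ (fun y => imCoord (gaussMap hF o ((extChartAt 𝓘(ℝ, E2) x).symm y)))
      (extChartAt 𝓘(ℝ, E2) x x) := by
  obtain ⟨W, hWo, hxW, hWt, hs⟩ := contDiffOn_inv_coordArea o hF ho x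
  have hp := contDiffOn_partialD hWo
    ((contDiffOn_comp_extChartAt_symm hF.smooth x).mono hWt)
  have h := hs.smul ((bivectorCLM.contDiff.comp_contDiffOn (hp 0)).clm_apply (hp 1))
  exact (h.congr fun y hy => imCoord_gaussMap_symm hF o (hWt hy)).contDiffAt (hWo.mem_nhds hxW)

theorem contMDiff_imCoord_gaussMap (ho : IsSurfaceOrientation o) :
    ContMDiff 𝓘(ℝ, E2) 𝓘(ℝ, Fin 3 → ℂ) ∞ (fun x => imCoord (gaussMap hF o x)) := fun x =>
  ((contDiffAt_imCoord_gaussMap_symm hF o ho x).contMDiffAt.comp x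
    contMDiffAt_extChartAt).congr_of_eventuallyEq (eventuallyEq_comp_extChartAt _ x)

theorem dQuat_eq_dirD (ho : IsSurfaceOrientation o) (x : M) (u : TangentSpace 𝓘(ℝ, E2) x) (a : E2)
    (ha : a = mfderiv 𝓘(ℝ, E2) 𝓘(ℝ, E2) (extChartAt 𝓘(ℝ, E2) x) x u) :
    dQuat (gaussMap hF o) x u =
      ofImCoord (dirD a (fun y => imCoord (gaussMap hF o ((extChartAt 𝓘(ℝ, E2) x).symm y)))
        (extChartAt 𝓘(ℝ, E2) x x)) :=
  congrArg ofImCoord (mfderiv_eq_dirD (fun z => imCoord (gaussMap hF o z)) x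
    ((contDiffAt_imCoord_gaussMap_symm hF o ho x).differentiableAt (by simp)) u a ha)

/-- The differential of the Gauss map, up to a multiple of the Gauss map. -/
theorem exists_dQuat_eq (ho : IsSurfaceOrientation o) (x : M) (u : TangentSpace 𝓘(ℝ, E2) x)
    (a : E2) (ha : a = mfderiv 𝓘(ℝ, E2) 𝓘(ℝ, E2) (extChartAt 𝓘(ℝ, E2) x) x u)
    (f : E2 → Mink) (hf : f = F ∘ (extChartAt 𝓘(ℝ, E2) x).symm) (y : E2)
    (hy : y = extChartAt 𝓘(ℝ, E2) x x) :
    ∃ c : ℂ, dQuat (gaussMap hF o) x u = (coordArea o x y : ℂ)⁻¹ •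
        ((a 0 : ℂ) • (bivector (partialD 0 (partialD 0 f) y) (partialD 1 f y)
          + bivector (partialD 0 f y) (partialD 0 (partialD 1 f) y))
        + (a 1 : ℂ) • (bivector (partialD 1 (partialD 0 f) y) (partialD 1 f y)
          + bivector (partialD 0 f y) (partialD 1 (partialD 1 f) y)))
      + c • bivector (partialD 0 f y) (partialD 1 f y) := by
  obtain ⟨W, hWo, hxW, hWt, hs⟩ := contDiffOn_inv_coordArea o hF ho x
  rw [← hy] at hxW
  have hp := contDiffOn_partialD hWo
    ((contDiffOn_comp_extChartAt_symm hF.smooth x).mono hWt)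
  rw [← hf] at hp
  have hd (i : Fin 2) := differentiableAt_of_contDiffOn hWo (hp i) hxW
  have hb : ContDiffOn ℝ ∞ (fun y => bivectorCLM (partialD 0 f y) (partialD 1 f y)) W :=
    (bivectorCLM.contDiff.comp_contDiffOn (hp 0)).clm_apply (hp 1)
  have hc : dirD a (fun y => imCoord (gaussMap hF o ((extChartAt 𝓘(ℝ, E2) x).symm y))) y =
      dirD a (fun y => (coordArea o x y)⁻¹ • bivectorCLM (partialD 0 f y) (partialD 1 f y)) y :=
    dirD_congr hWo (fun z hz => hf ▸ imCoord_gaussMap_symm hF o (hWt hz)) hxW a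
  rw [dirD_smul (differentiableAt_of_contDiffOn hWo hs hxW)
    (differentiableAt_of_contDiffOn hWo hb hxW), dirD_bilin bivectorCLM (hd 0) (hd 1)] at hc
  -- Product rule for `δ⁻¹ (f₀ ∧ f₁)`: the derivative of `δ⁻¹` is the coefficient of `f₀ ∧ f₁`.
  refine ⟨(dirD a (fun y => (coordArea o x y)⁻¹) y : ℝ), ?_⟩
  rw [dQuat_eq_dirD hF o ho x u a ha, ← hy, hc]
  simp only [bivectorCLM_apply, real_smul_eq, ← imCoord_smul, ← imCoord_add]
  rw [ofImCoord_imCoord (by simp [bivector_re]), Complex.ofReal_inv]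
  simp only [dirD_eq_sum a (partialD _ f), bivector_add_left, bivector_add_right,
    bivector_smul_left, bivector_smul_right]
  module


end MinkowskiSurface

namespace MinkowskiSurface

/-! ### Complex lines of the tangent planes of the quadric -/

/-- The triple product is trilinear and alternating, so the components along `P` drop out. -/
theorem mixed_combination (A B P : ℍ[ℂ]) (hP : P.re = 0) (a₀ a₁ b₀ b₁ c d s : ℂ) :
    mixed (s • (a₀ • A + a₁ • B) + c • P) (s • (b₀ • A + b₁ • B) + d • P) (s • P) =
      s ^ 3 * (a₀ * b₁ - a₁ * b₀) * mixed A B P := by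
  rw [mixed_eq _ _ P hP, mixed_eq _ _ _ (by simp [hP])]
  simp
  ring

theorem zero_smul_quaternion (q : ℍ[ℂ]) : (0 : ℂ) • q = 0 := by
  ext <;> simp

/-- Supplies a complex line when both tangent vectors vanish. -/
theorem exists_mem_quadricTangent_ne_zero (p : ℍ[ℂ]) :
    ∃ η ∈ quadricTangent p, η ≠ 0 := by
  by_cases h : p.imI = 0 ∧ p.imJ = 0
  · refine ⟨⟨0, 1, 0, 0⟩, ⟨rfl, by simp [bilinH, h.1]⟩, fun h0 => ?_⟩
    exact one_ne_zero (congrArg QuaternionAlgebra.imI h0)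
  · refine ⟨⟨0, p.imJ, -p.imI, 0⟩, ⟨rfl, by simp [bilinH]; ring⟩, fun h0 => h ⟨?_, ?_⟩⟩
    · exact neg_eq_zero.1 (congrArg QuaternionAlgebra.imJ h0)
    · exact congrArg QuaternionAlgebra.imI h0

/-- Two tangent vectors of the quadric on which the area form vanishes are dependent. -/
theorem exists_smul_eq_of_mixed_eq_zero {p ξ ξ' : ℍ[ℂ]} (hp : p ∈ quadric)
    (hξ : ξ ∈ quadricTangent p) (hξ' : ξ' ∈ quadricTangent p) (h : mixed ξ ξ' p = 0)
    (h0 : ξ ≠ 0) : ∃ c : ℂ, c • ξ = ξ' := by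
  obtain ⟨hp0, hp1⟩ := hp
  obtain ⟨k0, k1⟩ := hξ
  obtain ⟨l0, l1⟩ := hξ'
  rw [mixed_eq _ _ _ hp0] at h
  simp only [bilinH, k0, l0, zero_mul, zero_add] at k1 l1
  -- Let `N = ξ × ξ'`. Then `N × p = 0`, because `ξ` and `ξ'` are orthogonal to `p`. As `H(p, p) =
  -- 1`, this gives `N = H(N, p) p = 0`, here coordinate by coordinate.
  have eI : ξ.imJ * ξ'.imK - ξ.imK * ξ'.imJ = 0 := by
    linear_combination p.imI * h - (ξ.imJ * ξ'.imK - ξ.imK * ξ'.imJ) * hp1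
      + (p.imJ * ξ'.imK - p.imK * ξ'.imJ) * k1 - (p.imJ * ξ.imK - p.imK * ξ.imJ) * l1
  have eJ : ξ.imK * ξ'.imI - ξ.imI * ξ'.imK = 0 := by
    linear_combination p.imJ * h - (ξ.imK * ξ'.imI - ξ.imI * ξ'.imK) * hp1
      + (p.imK * ξ'.imI - p.imI * ξ'.imK) * k1 - (p.imK * ξ.imI - p.imI * ξ.imK) * l1
  have eK : ξ.imI * ξ'.imJ - ξ.imJ * ξ'.imI = 0 := by
    linear_combination p.imK * h - (ξ.imI * ξ'.imJ - ξ.imJ * ξ'.imI) * hp1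
      + (p.imI * ξ'.imJ - p.imJ * ξ'.imI) * k1 - (p.imI * ξ.imJ - p.imJ * ξ.imI) * l1
  -- `H(ξ, ξ)` may vanish for `ξ ≠ 0`, so the ratio is read off a nonzero coordinate of `ξ`.
  by_cases hI : ξ.imI = 0
  · by_cases hJ : ξ.imJ = 0
    · by_cases hK : ξ.imK = 0
      · exact absurd (QuaternionAlgebra.ext k0 hI hJ hK) h0
      · refine ⟨ξ'.imK / ξ.imK, ?_⟩
        ext <;> simp only [Quaternion.re_smul, Quaternion.imI_smul, Quaternion.imJ_smul,
          Quaternion.imK_smul, smul_eq_mul, k0, l0, mul_zero] <;> field_simp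
        · linear_combination -eJ
        · linear_combination eI
    · refine ⟨ξ'.imJ / ξ.imJ, ?_⟩
      ext <;> simp only [Quaternion.re_smul, Quaternion.imI_smul, Quaternion.imJ_smul,
        Quaternion.imK_smul, smul_eq_mul, k0, l0, mul_zero] <;> field_simp
      · linear_combination eK
      · linear_combination -eI
  · refine ⟨ξ'.imI / ξ.imI, ?_⟩
    ext <;> simp only [Quaternion.re_smul, Quaternion.imI_smul, Quaternion.imJ_smul,
      Quaternion.imK_smul, smul_eq_mul, k0, l0, mul_zero] <;> field_simp
    · linear_combination -eK
    · linear_combination eJ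

theorem exists_generator_of_finrank_eq_one {V : Type*} [AddCommGroup V] [Module ℂ V]
    (L : Submodule ℂ V) (hL : finrank ℂ L = 1) : ∃ v : V, ∀ w ∈ L, ∃ c : ℂ, c • v = w := by
  obtain ⟨v, -, hv⟩ := finrank_eq_one_iff'.1 hL
  refine ⟨v, fun w hw => ?_⟩
  obtain ⟨c, hc⟩ := hv ⟨w, hw⟩
  exact ⟨c, congrArg Subtype.val hc⟩

/-- The area form of the quadric vanishes on two tangent vectors exactly when they belong to a
complex line. -/
theorem mixed_eq_zero_iff {p ξ ξ' : ℍ[ℂ]} (hp : p ∈ quadric)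
    (hξ : ξ ∈ quadricTangent p) (hξ' : ξ' ∈ quadricTangent p) :
    mixed ξ ξ' p = 0 ↔ ∃ L : Submodule ℂ ℍ[ℂ], finrank ℂ L = 1 ∧ L ≤ quadricTangent p ∧
      ξ ∈ L ∧ ξ' ∈ L := by
  constructor
  · intro h
    obtain ⟨η, hη, hη0, h1, h2⟩ : ∃ η ∈ quadricTangent p, η ≠ 0 ∧
        (∃ c : ℂ, c • η = ξ) ∧ ∃ c : ℂ, c • η = ξ' := by
      by_cases h0 : ξ = 0
      · by_cases h1 : ξ' = 0
        · obtain ⟨η, hη, hη0⟩ := exists_mem_quadricTangent_ne_zero p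
          exact ⟨η, hη, hη0, ⟨0, by rw [h0, zero_smul_quaternion]⟩, ⟨0, by rw [h1, zero_smul_quaternion]⟩⟩
        · exact ⟨ξ', hξ', h1, ⟨0, by rw [h0, zero_smul_quaternion]⟩, ⟨1, one_smul _ _⟩⟩
      · exact ⟨ξ, hξ, h0, ⟨1, one_smul _ _⟩,
          exists_smul_eq_of_mixed_eq_zero hp hξ hξ' h h0⟩
    exact ⟨Submodule.span ℂ {η}, finrank_span_singleton hη0,
      (Submodule.span_singleton_le_iff_mem _ _).2 hη, Submodule.mem_span_singleton.2 h1,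
      Submodule.mem_span_singleton.2 h2⟩
  · rintro ⟨L, hL, -, h1, h2⟩
    obtain ⟨η, hη⟩ := exists_generator_of_finrank_eq_one L hL
    obtain ⟨c, hc⟩ := hη ξ h1
    obtain ⟨d, hd⟩ := hη ξ' h2
    rw [← hc, ← hd, mixed_eq _ _ _ hp.1]
    simp
    ring

/-! ### The pull-back of the area form -/

variable {M : Type*} [TopologicalSpace M] [ChartedSpace E2 M]

theorem dQuat_add (G : M → ℍ[ℂ]) (x : M) (u v : TangentSpace 𝓘(ℝ, E2) x) :
    dQuat G x (u + v) = dQuat G x u + dQuat G x v :=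
  (congrArg ofImCoord (map_add (mfderiv 𝓘(ℝ, E2) 𝓘(ℝ, Fin 3 → ℂ)
    (fun z => imCoord (G z)) x) u v)).trans (ofImCoord_add _ _)

theorem dQuat_smul (G : M → ℍ[ℂ]) (x : M) (c : ℝ) (u : TangentSpace 𝓘(ℝ, E2) x) :
    dQuat G x (c • u) = (c : ℂ) • dQuat G x u :=
  (congrArg ofImCoord ((map_smul (mfderiv 𝓘(ℝ, E2) 𝓘(ℝ, Fin 3 → ℂ)
    (fun z => imCoord (G z)) x) c u).trans (real_smul_eq c _))).trans (ofImCoord_smul _ _)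

variable [RiemannianBundle (fun x : M => TangentSpace 𝓘(ℝ, E2) x)]
  {F : M → Mink} (hF : IsIsometricImmersion F)
  (o : ∀ x : M, Orientation ℝ (TangentSpace 𝓘(ℝ, E2) x) (Fin 2))
  [IsManifold 𝓘(ℝ, E2) ∞ M]

/-- The standard complex bilinear form of `ℂ³`, as a real bilinear map. -/
noncomputable def dotCLM : (Fin 3 → ℂ) →L[ℝ] (Fin 3 → ℂ) →L[ℝ] ℂ :=
  (LinearMap.mk₂ ℝ (fun z w : Fin 3 → ℂ => z 0 * w 0 + z 1 * w 1 + z 2 * w 2)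
    (fun u v w => by simp only [Pi.add_apply]; ring)
    (fun c v w => by simp only [Pi.smul_apply, Complex.real_smul]; ring)
    (fun u v w => by simp only [Pi.add_apply]; ring)
    (fun c v w => by simp only [Pi.smul_apply, Complex.real_smul]; ring)).toContinuousBilinearMap

theorem dotCLM_apply (z w : Fin 3 → ℂ) :
    dotCLM z w = z 0 * w 0 + z 1 * w 1 + z 2 * w 2 := rfl

/-- Derivative of the constraint `H(G, G) = 1`. -/
theorem dQuat_mem_quadricTangent (ho : IsSurfaceOrientation o) (x : M)
    (u : TangentSpace 𝓘(ℝ, E2) x) :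
    dQuat (gaussMap hF o) x u ∈ quadricTangent (gaussMap hF o x) := by
  rw [dQuat_eq_dirD hF o ho x u _ rfl]
  refine ⟨rfl, ?_⟩
  generalize hg : (fun y => imCoord (gaussMap hF o ((extChartAt 𝓘(ℝ, E2) x).symm y))) = g
  have hd : DifferentiableAt ℝ g (extChartAt 𝓘(ℝ, E2) x x) :=
    hg ▸ (contDiffAt_imCoord_gaussMap_symm hF o ho x).differentiableAt (by simp)
  have h1 (y : E2) : dotCLM (g y) (g y) = 1 := by
    have h := (gaussMap_mem_quadric hF o ((extChartAt 𝓘(ℝ, E2) x).symm y)).2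
    rw [← hg, dotCLM_apply]
    simpa [imCoord, pow_two] using h
  generalize (mfderiv 𝓘(ℝ, E2) 𝓘(ℝ, E2) (extChartAt 𝓘(ℝ, E2) x) x u : E2) = a
  have h2 := dirD_bilin dotCLM hd hd a
  simp only [h1] at h2
  have h3 : dirD a (fun _ : E2 => (1 : ℂ)) (extChartAt 𝓘(ℝ, E2) x x) = 0 := by
    unfold dirD
    rw [fderiv_fun_const]
    rfl
  have h4 : g (extChartAt 𝓘(ℝ, E2) x x) = imCoord (gaussMap hF o x) := by
    rw [← hg]
    simp only [extChartAt_to_inv]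
  rw [h3, h4, dotCLM_apply, dotCLM_apply] at h2
  simp only [imCoord, Matrix.cons_val_zero, Matrix.cons_val_one, Matrix.cons_val] at h2
  simp only [bilinH, ofImCoord]
  linear_combination -(1 / 2) * h2

theorem omegaQ_dQuat (ho : IsSurfaceOrientation o) (x : M) (u v : TangentSpace 𝓘(ℝ, E2) x) :
    omegaQ (gaussMap hF o x) (dQuat (gaussMap hF o) x u) (dQuat (gaussMap hF o) x v) =
      ((gaussCurvature x : ℂ) + Complex.I * (normalCurvature hF o x : ℂ)) *
        ((o x).areaForm u v : ℂ) := by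
  obtain ⟨y, hy⟩ : ∃ y, y = extChartAt 𝓘(ℝ, E2) x x := ⟨_, rfl⟩
  have hm : y ∈ (extChartAt 𝓘(ℝ, E2) x).target := hy ▸ mem_extChartAt_target x
  have hx : (extChartAt 𝓘(ℝ, E2) x).symm y = x := hy ▸ extChartAt_to_inv x
  obtain ⟨f, hf⟩ : ∃ f, f = F ∘ (extChartAt 𝓘(ℝ, E2) x).symm := ⟨_, rfl⟩
  obtain ⟨a, ha⟩ : ∃ a : E2, a = mfderiv 𝓘(ℝ, E2) 𝓘(ℝ, E2) (extChartAt 𝓘(ℝ, E2) x) x u :=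
    ⟨_, rfl⟩
  obtain ⟨b, hb⟩ : ∃ b : E2, b = mfderiv 𝓘(ℝ, E2) 𝓘(ℝ, E2) (extChartAt 𝓘(ℝ, E2) x) x v :=
    ⟨_, rfl⟩
  obtain ⟨c, hc⟩ := exists_dQuat_eq hF o ho x u a ha f hf y hy
  obtain ⟨d, hd⟩ := exists_dQuat_eq hF o ho x v b hb f hf y hy
  have hn : IsNormalFrame (dMink F x (tangentFrame o x 0)) (dMink F x (tangentFrame o x 1))
      (normalFrame hF o x).1 (normalFrame hF o x).2 :=
    Classical.choose_spec (exists_normalFrame (tangentFrame_pair hF o x))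
  obtain ⟨p, q, r, s, h0, h1, hδ⟩ := exists_frame_coeff o x hF hm hx
  rw [← hf] at h0 h1
  have hne := coordArea_ne_zero o hm
  have hnormal {n : Mink} (k0 : mink n (dMink F x (tangentFrame o x 0)) = 0)
      (k1 : mink n (dMink F x (tangentFrame o x 1)) = 0) (k : Fin 2) :
      mink n (partialD k f y) = 0 := by
    fin_cases k
    · simp [h0, mink_add_right, mink_smul_right, k0, k1]
    · simp [h1, mink_add_right, mink_smul_right, k0, k1]
  have hK := gaussCurvature_mul o hF x f hf y hy
  have hKN := normalCurvature_mul hF o x f hf y hy (normalFrame hF o x).1 (normalFrame hF o x).2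
    rfl (hnormal hn.normal.1 hn.normal.2.1) (hnormal hn.normal.2.2.1 hn.normal.2.2.2)
  have hP := bivector_partialD hF o hm
  rw [hx, ← hf] at hP
  have hG : gaussMap hF o x =
      (coordArea o x y : ℂ)⁻¹ • bivector (partialD 0 f y) (partialD 1 f y) := by
    rw [hP, smul_smul, inv_mul_cancel₀ (Complex.ofReal_ne_zero.2 hne), one_smul]
  -- Each of the three arguments carries a factor `δ⁻¹`. Against the `δ⁴` of `mixed_eq_curvature`
  -- this leaves one `δ`, which with `a 0 * b 1 - a 1 * b 0` is the area of `(u, v)`.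
  rw [areaForm_eq_coordArea_of_eq o hm hx u v a b ha hb, omegaQ, hc, hd, hG,
    mixed_combination _ _ _ (bivector_re _ _)]
  rw [hδ] at hK hKN hne ⊢
  rw [mixed_eq_curvature (isOpen_extChartAt_target (I := 𝓘(ℝ, E2)) x)
    (hf ▸ contDiffOn_comp_extChartAt_symm hF.smooth x) hm (tangentFrame_pair hF o x) hn h0 h1 hne
    hK hKN]
  have hne' := Complex.ofReal_ne_zero.2 hne
  generalize p * s - q * r = δ at *
  push_cast
  field_simp

theorem curvatures_eq_zero_iff (ho : IsSurfaceOrientation o) (x : M) :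
    (gaussCurvature x = 0 ∧ normalCurvature hF o x = 0) ↔
      ∃ L : Submodule ℂ ℍ[ℂ], finrank ℂ L = 1 ∧ L ≤ quadricTangent (gaussMap hF o x) ∧
        ∀ u : TangentSpace 𝓘(ℝ, E2) x, dQuat (gaussMap hF o) x u ∈ L := by
  have h := omegaQ_dQuat hF o ho x (tangentFrame o x 0) (tangentFrame o x 1)
  rw [areaForm_tangentFrame, Complex.ofReal_one, mul_one, omegaQ] at h
  have h1 : (gaussCurvature x = 0 ∧ normalCurvature hF o x = 0) ↔
      (gaussCurvature x : ℂ) + Complex.I * (normalCurvature hF o x : ℂ) = 0 := by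
    simp [Complex.ext_iff]
  rw [h1, ← h, mixed_eq_zero_iff (gaussMap_mem_quadric hF o x)
    (dQuat_mem_quadricTangent hF o ho x _) (dQuat_mem_quadricTangent hF o ho x _)]
  -- A complex line containing the images of a real basis of the tangent plane contains the whole
  -- image of the differential.
  refine exists_congr fun L => and_congr_right fun _ => and_congr_right fun _ =>
    ⟨fun ⟨k0, k1⟩ u => ?_, fun k => ⟨k _, k _⟩⟩
  rw [eq_sum_tangentFrame o x u, dQuat_add, dQuat_smul, dQuat_smul]
  exact L.add_mem (L.smul_mem _ k0) (L.smul_mem _ k1)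

end MinkowskiSurface

theorem proposition6p3 {M : Type*} [TopologicalSpace M] [ChartedSpace E2 M]
    [IsManifold 𝓘(ℝ, E2) ∞ M] [RiemannianBundle (fun x : M => TangentSpace 𝓘(ℝ, E2) x)]
    (F : M → Mink) (hF : IsIsometricImmersion F)
    (o : ∀ x : M, Orientation ℝ (TangentSpace 𝓘(ℝ, E2) x) (Fin 2))
    (ho : IsSurfaceOrientation o) :
    -- the Grassmannian is identified with the quadric, and the Gauss map is a smooth map to it
    Function.Bijective planeToQuadric ∧
    ContMDiff 𝓘(ℝ, E2) 𝓘(ℝ, Fin 3 → ℂ) ∞ (fun x => imCoord (gaussMap hF o x)) ∧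
    (∀ (x : M) (u : TangentSpace 𝓘(ℝ, E2) x),
      dQuat (gaussMap hF o) x u ∈ quadricTangent (gaussMap hF o x)) ∧
    -- the pull-back formula
    (∀ (x : M) (u v : TangentSpace 𝓘(ℝ, E2) x),
      omegaQ (gaussMap hF o x) (dQuat (gaussMap hF o) x u) (dQuat (gaussMap hF o) x v) =
        ((gaussCurvature x : ℂ) + Complex.I * (normalCurvature hF o x : ℂ)) *
          ((o x).areaForm u v : ℂ)) ∧
    -- the characterization of the points where both curvatures vanish
    (∀ x : M, (gaussCurvature x = 0 ∧ normalCurvature hF o x = 0) ↔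
      ∃ L : Submodule ℂ ℍ[ℂ], finrank ℂ L = 1 ∧ L ≤ quadricTangent (gaussMap hF o x) ∧
        ∀ u : TangentSpace 𝓘(ℝ, E2) x, dQuat (gaussMap hF o) x u ∈ L) :=
  ⟨⟨planeToQuadric_injective, planeToQuadric_surjective⟩, contMDiff_imCoord_gaussMap hF o ho,
    dQuat_mem_quadricTangent hF o ho, omegaQ_dQuat hF o ho, curvatures_eq_zero_iff hF o ho⟩
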